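/- **Conventions.** A *topological groupoid* is a groupoid $G$ (identified with its arrow space, with object space $G^{(0)}\subset G$, source $s$ and range $r$; $xy$ is defined iff $s(x)=r(y)$) with a locally compact Hausdorff topology making composition and inversion (hence $s,r$) continuous, together with a fixed Haar system: positive Radon measures $\mu^u$, $u\in G^{(0)}$, with $\operatorname{supp}\mu^u=G^u=r^{-1}(u)$, with $u\mapsto\int f\,d\mu^u$ continuous for every $f\in C_c(G)$, and with $\int f(y)\,d\mu^{r(x)}(y)=\int f(xy)\,d\mu^{s(x)}(y)$ for all $x\in G$, $f\in C_c(G)$. A *2-cocycle* on $G$ is a continuous map $\sigma:G^{(2)}\to\mathbb T$ on the composable pairs with $\sigma(g,h)\sigma(gh,k)=\sigma(g,hk)\sigma(h,k)$ whenever $(g,h),(h,k)\in G^{(2)}$, normalized by $\sigma(u,u)=1$ for all $u\in G^{(0)}$. $C_c(G,\sigma)$ is $C_c(G)$ with $$(f*g)(x)=\int f(xy)\,g(y^{-1})\,\sigma(xy,y^{-1})\,d\mu^{s(x)}(y),\qquad f^*(x)=\overline{f(x^{-1})\,\sigma(x,x^{-1})},$$ $$\|f\|_I=\max\Big\{\sup_{u}\int|f(x)|\,d\mu^u(x),\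 \sup_{u}\int|f(x^{-1})|\,d\mu^u(x)\Big\}.$$ The maximal norm is $\|f\|_{\max}=\sup_\pi\|\pi(f)\|$ over all $\|\cdot\|_I$-continuous $*$-representations $\pi$ of $C_c(G,\sigma)$ on Hilbert spaces. The minimal (reduced) norm is $\|f\|_r=\sup_{u\in G^{(0)}}\|\mathrm{Ind}(\delta_u)(f)\|$, where $\mathrm{Ind}(\delta_u)$ is the representation on $L^2(G_u,\mu_u)$, with $G_u=s^{-1}(u)$ and $\mu_u$ the image of $\mu^u$ under inversion, given by $$\mathrm{Ind}(\delta_u)(f)(\xi)(x)=\int f(xy)\,\xi(y^{-1})\,\sigma(xy,y^{-1})\,d\mu^u(y).$$ $C^*(G,\sigma)$ and $C^*_r(G,\sigma)$ are the completions of $C_c(G,\sigma)$ in these two norms. A *partial morphism* $(\varphi,K):(G,\sigma_G)\to(H,\sigma_H)$ is an open subgroupoid $K\subset G$, with the restricted Haar system and cocycle, and a proper continuous functor $\varphi:K\to H$ such that $\varphi_*(\mu^u|_K)=\nu^{\varphi(u)}$ for all $u\in K^{(0)}$ (where $\nu$ is the Haar system of $H$) and $\sigma_G(g,h)=\sigma_H(\varphi(g),\varphi(h))$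 for all composable $g,h\in K$. The composition of $(\varphi,K)$ with $(\psi,L)$ is $\psi\circ\varphi$ on the domain $\varphi^{-1}(L)$. Its *induced map* $\varphi^*:C_c(H,\sigma_H)\to C_c(G,\sigma_G)$ sends $f$ to $f\circ\varphi$ on $K$, extended by $0$ to $G$. Let $\mathcal G_\sigma$ be the category of pairs $(G,\sigma)$ and partial morphisms, and $\mathcal C$ the category of (not necessarily unital) C*-algebras and $*$-homomorphisms. A locally compact Hausdorff space $X$ is viewed as an object of $\mathcal G_\sigma$ in which all arrows are units, with Haar system $(\delta_x)_{x\in X}$ and the trivial cocycle, and a proper continuous map is viewed as an everywhere defined partial morphism. The Gelfand duality functor $\Gamma_c$ sends $X$ to $C_0(X)$ and a proper continuous map $f$ to the pullback $f^*$. **Theorem.** There is a contravariant functor $\Gamma^\sigma_{\max}$ (respectively $\Gamma^\sigma_{\min}$) from $\mathcal G_\sigma$ to $\mathcal C$ which sends each $(G,\sigma)$ to its maximal twisted groupoid C*-algebra $C^*(G,\sigma)$ (respectively its minimal one $C^*_r(G,\sigma)$), and each partial morphism $\varphi:(G,\sigma_G)\to(H,\sigma_H)$ to the $*$-homomorphism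 between the completions that extends the induced map $\varphi^*:C_c(H,\sigma_H)\to C_c(G,\sigma_G)$. Moreover both functors extend the Gelfand duality functor: on locally compact Hausdorff spaces and proper continuous maps each of them is naturally isomorphic to $\Gamma_c$, by an isomorphism which extends the inclusions $C_c(X)\subset C_0(X)$. -/

import Mathlib

open CategoryTheory MeasureTheory Topology Set Filter
open scoped CompactlySupported ZeroAtInfty ComplexConjugate

universe u

noncomputable section

/-! ## The category of C*-algebras and all (not necessarily unital) `*`-homomorphisms -/

/-- A (complex, not necessarily unital) C*-algebra, as an object of a category. -/
structure CStarCat : Type (u + 1) where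
  carrier : Type u
  [str : NonUnitalCStarAlgebra carrier]

namespace CStarCat

instance : CoeSort CStarCat.{u} (Type u) := ⟨carrier⟩

instance (A : CStarCat.{u}) : NonUnitalCStarAlgebra A := A.str

/-- Morphisms of C*-algebras: `*`-homomorphisms. -/
@[ext]
structure Hom (A B : CStarCat.{u}) where
  hom : A →⋆ₙₐ[ℂ] B

instance : Category CStarCat.{u} where
  Hom A B := Hom A B
  id A := ⟨NonUnitalStarAlgHom.id ℂ A⟩
  comp f g := ⟨g.hom.comp f.hom⟩

end CStarCat

/-! ## Topological groupoids with Haar systems, and 2-cocycles -/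

/-- A topological groupoid: a groupoid (object space `Obj`, arrow space `Arr`, `mul x y` defined when
the source of `x` is the range of `y`) with a locally compact Hausdorff topology and continuous
structure maps, carrying a fixed (left) Haar system `haar u`, `u : Obj`, of Radon measures.
The object space is homeomorphic, through `one`, to the subspace of unit arrows. -/
structure HaarGroupoid : Type (u + 1) where
  Obj : Type u
  Arr : Type u
  [topObj : TopologicalSpace Obj]
  [topArr : TopologicalSpace Arr]
  [t2 : T2Space Arr]
  [lc : LocallyCompactSpace Arr]
  [meas : MeasurableSpace Arr]
  [borel : BorelSpace Arr]
  src : Arr → Obj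
  rng : Arr → Obj
  one : Obj → Arr
  inv : Arr → Arr
  mul : ∀ x y : Arr, src x = rng y → Arr
  src_one : ∀ u, src (one u) = u
  rng_one : ∀ u, rng (one u) = u
  src_inv : ∀ x, src (inv x) = rng x
  rng_inv : ∀ x, rng (inv x) = src x
  src_mul : ∀ x y h, src (mul x y h) = src y
  rng_mul : ∀ x y h, rng (mul x y h) = rng x
  mul_assoc : ∀ x y z (hxy : src x = rng y) (hyz : src y = rng z),
    mul (mul x y hxy) z ((src_mul x y hxy).trans hyz) =
      mul x (mul y z hyz) (hxy.trans (rng_mul y z hyz).symm)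
  one_mul : ∀ x, mul (one (rng x)) x (src_one (rng x)) = x
  mul_one : ∀ x, mul x (one (src x)) (rng_one (src x)).symm = x
  inv_mul : ∀ x, mul (inv x) x (src_inv x) = one (src x)
  mul_inv : ∀ x, mul x (inv x) (rng_inv x).symm = one (rng x)
  continuous_src : Continuous src
  continuous_rng : Continuous rng
  continuous_one : Continuous one
  continuous_inv : Continuous inv
  continuous_mul : Continuous fun p : {p : Arr × Arr // src p.1 = rng p.2} => mul p.1.1 p.1.2 p.2
  /-- The Haar system `u ↦ μ^u`. -/
  haar : Obj → Measure Arr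
  haar_regular : ∀ u, (haar u).Regular
  haar_support : ∀ u, (haar u).support = {x | rng x = u}
  haar_continuous : ∀ f : C_c(Arr, ℂ), Continuous fun u => ∫ x, f x ∂(haar u)
  /-- Left invariance, `∫ f(y) dμ^{r(x)}(y) = ∫ f(xy) dμ^{s(x)}(y)`; as `μ^{s(x)}` lives on the
  arrows with range `s(x)`, the value `0` given to the integrand elsewhere is immaterial. -/
  haar_invariant : ∀ (x : Arr) (f : C_c(Arr, ℂ)), ∫ y, f y ∂(haar (rng x)) =
    ∫ y, (open Classical in if h : src x = rng y then f (mul x y h) else 0) ∂(haar (src x))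

attribute [instance] HaarGroupoid.topObj HaarGroupoid.topArr HaarGroupoid.t2 HaarGroupoid.lc
  HaarGroupoid.meas HaarGroupoid.borel HaarGroupoid.haar_regular

/-- A pair `(G, σ)`: a topological groupoid with Haar system and a continuous normalized circle-valued
2-cocycle on the space of composable pairs. -/
structure TwistedGroupoid : Type (u + 1) extends HaarGroupoid.{u} where
  cocycle : ∀ x y : Arr, src x = rng y → Circle
  continuous_cocycle :
    Continuous fun p : {p : Arr × Arr // src p.1 = rng p.2} => cocycle p.1.1 p.1.2 p.2
  cocycle_identity : ∀ x y z (hxy : src x = rng y) (hyz : src y = rng z),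
    cocycle x y hxy * cocycle (mul x y hxy) z ((src_mul x y hxy).trans hyz) =
      cocycle x (mul y z hyz) (hxy.trans (rng_mul y z hyz).symm) * cocycle y z hyz
  /-- Normalization; with the cocycle identity it gives `σ(r(x), x) = 1 = σ(x, s(x))`. -/
  cocycle_one : ∀ u, cocycle (one u) (one u) ((src_one u).trans (rng_one u).symm) = 1

/-! ## The twisted convolution algebra -/

section Continuity

theorem exists_compactlySupported_eqOn {X : Type*} [TopologicalSpace X] [T2Space X]
    [LocallyCompactSpace X] {S : Set X} (hS : IsClosed S) {F : X → ℂ} (hF : ContinuousOn F S)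
    {K : Set X} (hK : IsCompact K) (hz : ∀ y ∈ S, y ∉ K → F y = 0) :
    ∃ g : C_c(X, ℂ), EqOn g F S := by
  obtain ⟨W, hW, hKW⟩ := exists_compact_superset hK
  have hc : CompactSpace ↥(W ∩ S) := isCompact_iff_compactSpace.1 (hW.inter_right hS)
  let e : ↥(W ∩ S) → OnePoint X := fun y => ((y : X) : OnePoint X)
  have he : IsClosedEmbedding e :=
    Continuous.isClosedEmbedding (OnePoint.continuous_coe.comp continuous_subtype_val)
      (fun a b h => Subtype.ext (OnePoint.coe_injective h))
  let f : C(↥(W ∩ S), ℂ) :=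
    ⟨fun y => F y, (hF.mono inter_subset_right).domRestrict⟩
  obtain ⟨h, hh⟩ := ContinuousMap.exists_extension' he f
  have hF' : ∀ y, y ∈ W → y ∈ S → h (y : OnePoint X) = F y :=
    fun y hyW hyS => congrFun hh ⟨y, hyW, hyS⟩
  obtain ⟨χ, h1, h0, hcs, -⟩ := exists_continuous_one_zero_of_isCompact hK
    (isOpen_interior (s := W)).isClosed_compl (disjoint_compl_right_iff_subset.2 hKW)
  refine ⟨⟨⟨fun y => (χ y : ℂ) * h (y : OnePoint X), ?_⟩, ?_⟩, ?_⟩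
  · exact (Complex.continuous_ofReal.comp χ.continuous).mul
      (h.continuous.comp OnePoint.continuous_coe)
  · exact HasCompactSupport.mul_right (hcs.comp_left (g := fun t : ℝ => (t : ℂ)) (by simp))
  · intro y hy
    change (χ y : ℂ) * h (y : OnePoint X) = F y
    by_cases hyK : y ∈ K
    · rw [h1 hyK, hF' y (interior_subset (hKW hyK)) hy]; simp
    · rw [hz y hy hyK]
      by_cases hyW : y ∈ W
      · rw [hF' y hyW hy, hz y hy hyK]; simp
      · rw [h0 (fun hi => hyW (interior_subset hi))]; simp

end Continuity

namespace HaarGroupoid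

variable (G : HaarGroupoid.{u})

theorem t2_obj : T2Space G.Obj :=
  T2Space.of_injective_continuous (f := G.one)
    (fun a b h => by rw [← G.src_one a, h, G.src_one]) G.continuous_one


theorem isClosed_fiber (u : G.Obj) : IsClosed {y | G.rng y = u} :=
  have := G.t2_obj
  isClosed_eq G.continuous_rng continuous_const

theorem ae_rng (u : G.Obj) : ∀ᵐ y ∂(G.haar u), G.rng y = u := by
  have h := Measure.support_mem_ae_of_regular (μ := G.haar u)
  rw [G.haar_support] at h
  exact h

theorem mul_congr {x x' y y' : G.Arr} (hx : x = x') (hy : y = y') (h : G.src x = G.rng y) :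
    G.mul x y h = G.mul x' y' (hx ▸ hy ▸ h) := by
  subst hx hy; rfl

theorem one_mul' {u : G.Obj} (x : G.Arr) (h : G.src (G.one u) = G.rng x) :
    G.mul (G.one u) x h = x := by
  obtain rfl : u = G.rng x := (G.src_one u).symm.trans h
  exact G.one_mul x

theorem mul_one' {u : G.Obj} (x : G.Arr) (h : G.src x = G.rng (G.one u)) :
    G.mul x (G.one u) h = x := by
  obtain rfl : u = G.src x := (G.rng_one u).symm.trans h.symm
  exact G.mul_one x

theorem inv_inv (x : G.Arr) : G.inv (G.inv x) = x := by
  have h1 := G.mul_assoc (G.inv (G.inv x)) (G.inv x) x (G.src_inv _) (G.src_inv _)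
  rw [G.mul_congr (G.inv_mul (G.inv x)) rfl, G.mul_congr rfl (G.inv_mul x), G.one_mul',
    G.mul_one'] at h1
  exact h1.symm

theorem mul_mul_inv (x y : G.Arr) (h : G.src x = G.rng y) :
    G.mul (G.mul x y h) (G.inv y) ((G.src_mul x y h).trans (G.rng_inv y).symm) = x := by
  rw [G.mul_assoc x y (G.inv y) h (G.rng_inv y).symm, G.mul_congr rfl (G.mul_inv y), G.mul_one']

theorem eq_one_of_mul_self (e : G.Arr) (h : G.src e = G.rng e) (he : G.mul e e h = e) :
    e = G.one (G.rng e) := by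
  have h1 := G.mul_mul_inv e e h
  rw [G.mul_congr he rfl, G.mul_inv] at h1
  exact h1.symm

theorem isCompact_inv_preimage {K : Set G.Arr} (hK : IsCompact K) :
    IsCompact (G.inv ⁻¹' K) := by
  have : G.inv ⁻¹' K = G.inv '' K := by
    ext x
    exact ⟨fun hx => ⟨G.inv x, hx, G.inv_inv x⟩, by
      rintro ⟨y, hy, rfl⟩; rw [mem_preimage, G.inv_inv]; exact hy⟩
  rw [this]
  exact hK.image G.continuous_inv

theorem eq_inv_of_mul_eq_one {a b : G.Arr} {u : G.Obj} (h : G.src a = G.rng b)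
    (he : G.mul a b h = G.one u) : a = G.inv b := by
  have h1 := G.mul_mul_inv a b h
  rw [G.mul_congr he rfl, G.one_mul'] at h1
  exact h1.symm

/-- Fibrewise continuous, fibrewise compactly supported functions are integrable. -/
theorem exists_ae_eq {Φ : G.Arr → G.Arr → ℂ}
    (hΦ : ContinuousOn (fun p : G.Arr × G.Arr => Φ p.1 p.2) {p | G.src p.1 = G.rng p.2})
    {K : Set G.Arr} (hK : IsCompact K) (hz : ∀ x y, y ∉ K → Φ x y = 0) (x : G.Arr) :
    ∃ g : C_c(G.Arr, ℂ), ∀ y, G.rng y = G.src x → g y = Φ x y :=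
  exists_compactlySupported_eqOn (G.isClosed_fiber (G.src x)) (F := Φ x)
    (hΦ.comp (f := fun y => (x, y)) (by fun_prop) fun _ hy => Eq.symm hy) hK fun y _ => hz x y

theorem integrable_fiber {Φ : G.Arr → G.Arr → ℂ}
    (hΦ : ContinuousOn (fun p : G.Arr × G.Arr => Φ p.1 p.2) {p | G.src p.1 = G.rng p.2})
    {K : Set G.Arr} (hK : IsCompact K) (hz : ∀ x y, y ∉ K → Φ x y = 0) (x : G.Arr) :
    Integrable (Φ x) (G.haar (G.src x)) := by
  obtain ⟨g, hg⟩ := G.exists_ae_eq hΦ hK hz x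
  refine (g.continuous.integrable_of_hasCompactSupport g.hasCompactSupport).congr ?_
  filter_upwards [G.ae_rng (G.src x)] with y hy using hg y hy

theorem continuous_integral {Φ : G.Arr → G.Arr → ℂ}
    (hΦ : ContinuousOn (fun p : G.Arr × G.Arr => Φ p.1 p.2) {p | G.src p.1 = G.rng p.2})
    {K : Set G.Arr} (hK : IsCompact K) (hz : ∀ x y, y ∉ K → Φ x y = 0) :
    Continuous fun x => ∫ y, Φ x y ∂(G.haar (G.src x)) := by
  have := G.t2_obj
  rw [continuous_iff_continuousAt]
  intro x₀
  obtain ⟨g, hg⟩ := G.exists_ae_eq hΦ hK hz x₀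
  have hg_int : ∀ u, Integrable g (G.haar u) := fun u =>
    g.continuous.integrable_of_hasCompactSupport g.hasCompactSupport
  set L : Set G.Arr := K ∪ tsupport g with hL
  have hLc : IsCompact L := hK.union g.hasCompactSupport
  obtain ⟨ψ, h1, -, hcs, h01⟩ := exists_continuous_one_zero_of_isCompact hLc
    isClosed_empty (disjoint_empty L)
  have hψ_int : ∀ u, Integrable ψ (G.haar u) := fun u =>
    ψ.continuous.integrable_of_hasCompactSupport hcs
  have hJ : Tendsto (fun x => ∫ y, g y ∂(G.haar (G.src x))) (𝓝 x₀)
      (𝓝 (∫ y, Φ x₀ y ∂(G.haar (G.src x₀)))) := by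
    have : ∫ y, Φ x₀ y ∂(G.haar (G.src x₀)) = ∫ y, g y ∂(G.haar (G.src x₀)) := by
      refine integral_congr_ae ?_
      filter_upwards [G.ae_rng (G.src x₀)] with y hy using (hg y hy).symm
    rw [this]
    exact ((G.haar_continuous g).comp G.continuous_src).continuousAt
  have hP : Continuous fun x => ∫ y, ψ y ∂(G.haar (G.src x)) := by
    have h := (G.haar_continuous ⟨⟨fun y => (ψ y : ℂ), by fun_prop⟩,
      hcs.comp_left (g := fun t : ℝ => (t : ℂ)) (by simp)⟩).comp G.continuous_src
    have h' := Complex.continuous_re.comp h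
    refine h'.congr fun x => ?_
    change (∫ y, (ψ y : ℂ) ∂(G.haar (G.src x))).re = _
    rw [integral_complex_ofReal, Complex.ofReal_re]
  have ho : (fun x => (∫ y, Φ x y ∂(G.haar (G.src x))) - ∫ y, g y ∂(G.haar (G.src x)))
      =o[𝓝 x₀] fun x => ∫ y, ψ y ∂(G.haar (G.src x)) := by
    rw [Asymptotics.isLittleO_iff]
    intro ε hε
    have hev : ∀ᶠ x in 𝓝 x₀, ∀ y ∈ L, G.src x = G.rng y → ‖Φ x y - g y‖ < ε := by
      apply hLc.eventually_forall_of_forall_eventually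
      intro y _
      by_cases hy : G.src x₀ = G.rng y
      · have hc : ContinuousWithinAt (fun p : G.Arr × G.Arr => ‖Φ p.1 p.2 - g p.2‖)
            {p | G.src p.1 = G.rng p.2} (x₀, y) :=
          ((hΦ (x₀, y) hy).sub (g.continuous.comp continuous_snd).continuousWithinAt).norm
        have : ‖Φ x₀ y - g y‖ < ε := by rw [hg y hy.symm]; simpa using hε
        have := hc.eventually (gt_mem_nhds this)
        exact eventually_nhdsWithin_iff.1 this
      · have ho : IsOpen {p : G.Arr × G.Arr | G.src p.1 ≠ G.rng p.2} :=
          isOpen_ne_fun (G.continuous_src.comp continuous_fst) (G.continuous_rng.comp continuous_snd)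
        filter_upwards [ho.mem_nhds (show (x₀, y) ∈ _ from hy)] with p hp h
        exact absurd h hp
    filter_upwards [hev] with x hx
    rw [← integral_sub (G.integrable_fiber hΦ hK hz x) (hg_int _)]
    have hnn : 0 ≤ ∫ y, ψ y ∂(G.haar (G.src x)) := integral_nonneg fun y => (h01 y).1
    rw [Real.norm_of_nonneg hnn, ← integral_const_mul]
    refine norm_integral_le_of_norm_le ((hψ_int _).const_mul ε) ?_
    filter_upwards [G.ae_rng (G.src x)] with y hy
    by_cases hyL : y ∈ L
    · rw [h1 hyL]; simpa using (hx y hyL hy.symm).le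
    · rw [hz x y fun h => hyL (Or.inl h), image_eq_zero_of_notMem_tsupport fun h => hyL (Or.inr h)]
      simpa using mul_nonneg hε.le (h01 y).1
  have hto : Tendsto (fun x => (∫ y, Φ x y ∂(G.haar (G.src x))) - ∫ y, g y ∂(G.haar (G.src x)))
      (𝓝 x₀) (𝓝 0) :=
    (ho.trans_isBigO (hP.continuousAt.isBigO_one ℝ)).tendsto_zero_of_tendsto tendsto_const_nhds
  have := hto.add hJ
  simpa [ContinuousAt] using this

end HaarGroupoid

namespace TwistedGroupoid

variable (G : TwistedGroupoid.{u})

/-- The integrand `f(xy) g(y⁻¹) σ(xy, y⁻¹)` of the twisted convolution. It makes sense when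
`s(x) = r(y)`, and it is put equal to zero elsewhere. -/
def convIntegrand (f g : G.Arr → ℂ) (x y : G.Arr) : ℂ :=
  open Classical in
  if h : G.src x = G.rng y then
    f (G.mul x y h) * g (G.inv y) *
      (G.cocycle (G.mul x y h) (G.inv y) ((G.src_mul x y h).trans (G.rng_inv y).symm) : ℂ)
  else 0

/-- Twisted convolution `(f * g)(x) = ∫ f(xy) g(y⁻¹) σ(xy, y⁻¹) dμ^{s(x)}(y)`. -/
def conv (f g : G.Arr → ℂ) (x : G.Arr) : ℂ :=
  ∫ y, G.convIntegrand f g x y ∂(G.haar (G.src x))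

theorem continuousOn_convIntegrand {f g : G.Arr → ℂ} (hf : Continuous f) (hg : Continuous g) :
    ContinuousOn (fun p : G.Arr × G.Arr => G.convIntegrand f g p.1 p.2)
      {p | G.src p.1 = G.rng p.2} := by
  rw [continuousOn_iff_continuous_domRestrict]
  have h1 : Continuous fun p : {p : G.Arr × G.Arr // G.src p.1 = G.rng p.2} =>
      f (G.mul p.1.1 p.1.2 p.2) := hf.comp G.continuous_mul
  have h2 : Continuous fun p : {p : G.Arr × G.Arr // G.src p.1 = G.rng p.2} =>
      g (G.inv p.1.2) :=
    hg.comp (G.continuous_inv.comp (continuous_snd.comp continuous_subtype_val))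
  have h3 : Continuous fun p : {p : G.Arr × G.Arr // G.src p.1 = G.rng p.2} =>
      (G.cocycle (G.mul p.1.1 p.1.2 p.2) (G.inv p.1.2)
        ((G.src_mul _ _ p.2).trans (G.rng_inv _).symm) : ℂ) := by
    refine continuous_subtype_val.comp (G.continuous_cocycle.comp
      (f := fun p : {p : G.Arr × G.Arr // G.src p.1 = G.rng p.2} =>
        (⟨(G.mul p.1.1 p.1.2 p.2, G.inv p.1.2), (G.src_mul _ _ p.2).trans (G.rng_inv _).symm⟩ :
          {p : G.Arr × G.Arr // G.src p.1 = G.rng p.2})) ?_)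
    exact Continuous.subtype_mk (G.continuous_mul.prodMk
      (G.continuous_inv.comp (continuous_snd.comp continuous_subtype_val))) _
  refine ((h1.mul h2).mul h3).congr fun p => ?_
  have hp : G.src p.1.1 = G.rng p.1.2 := p.2
  simp [Set.domRestrict, convIntegrand, hp]

theorem convIntegrand_eq_zero {f g : G.Arr → ℂ} (x y : G.Arr)
    (hy : y ∉ G.inv ⁻¹' tsupport g) : G.convIntegrand f g x y = 0 := by
  unfold convIntegrand
  split_ifs with h
  · rw [image_eq_zero_of_notMem_tsupport hy]; simp
  · rfl

theorem continuous_conv (f g : C_c(G.Arr, ℂ)) : Continuous (G.conv f g) :=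
  G.continuous_integral (G.continuousOn_convIntegrand f.continuous g.continuous)
    (G.isCompact_inv_preimage g.hasCompactSupport) fun _ _ => G.convIntegrand_eq_zero _ _

theorem integrable_convIntegrand (f g : C_c(G.Arr, ℂ)) (x : G.Arr) :
    Integrable (G.convIntegrand f g x) (G.haar (G.src x)) :=
  G.integrable_fiber (G.continuousOn_convIntegrand f.continuous g.continuous)
    (G.isCompact_inv_preimage g.hasCompactSupport) (fun _ _ => G.convIntegrand_eq_zero _ _) x

theorem hasCompactSupport_conv (f g : C_c(G.Arr, ℂ)) : HasCompactSupport (G.conv f g) := by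
  have := G.t2_obj
  have hcl : IsClosed {p : G.Arr × G.Arr | G.src p.1 = G.rng p.2} :=
    isClosed_eq (G.continuous_src.comp continuous_fst) (G.continuous_rng.comp continuous_snd)
  have hK : IsCompact ((fun p : {p : G.Arr × G.Arr // G.src p.1 = G.rng p.2} =>
      G.mul p.1.1 p.1.2 p.2) '' (Subtype.val ⁻¹' (tsupport f ×ˢ tsupport g))) :=
    ((IsClosedEmbedding.subtypeVal hcl).isCompact_preimage
      (f.hasCompactSupport.isCompact.prod g.hasCompactSupport.isCompact)).image G.continuous_mul
  refine HasCompactSupport.intro hK fun x hx => ?_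
  unfold conv
  refine (integral_congr_ae (Eventually.of_forall fun y => ?_)).trans
    (integral_zero G.Arr ℂ)
  change G.convIntegrand f g x y = 0
  by_contra hne
  unfold convIntegrand at hne
  split_ifs at hne with h
  · have h1 : f (G.mul x y h) ≠ 0 := fun h0 => hne (by simp [h0])
    have h2 : g (G.inv y) ≠ 0 := fun h0 => hne (by simp [h0])
    exact hx ⟨⟨(G.mul x y h, G.inv y), (G.src_mul x y h).trans (G.rng_inv y).symm⟩,
      ⟨subset_tsupport _ h1, subset_tsupport _ h2⟩, G.mul_mul_inv x y h⟩
  · exact hne rfl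

/-- `C_c(G, σ)`: the continuous compactly supported functions on the arrow space, with twisted
convolution as multiplication and the twisted involution. That the axioms of a `*`-algebra hold
follows once it is embedded in a C*-algebra by a map respecting these operations. -/
def Cc : Type u := C_c(G.Arr, ℂ)

namespace Cc

variable {G}

instance : FunLike G.Cc G.Arr ℂ := inferInstanceAs (FunLike C_c(G.Arr, ℂ) G.Arr ℂ)

instance : AddCommGroup G.Cc := inferInstanceAs (AddCommGroup C_c(G.Arr, ℂ))

instance : Module ℂ G.Cc := inferInstanceAs (Module ℂ C_c(G.Arr, ℂ))

instance : Mul G.Cc where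
  mul f g := (⟨⟨G.conv f g, G.continuous_conv f g⟩, G.hasCompactSupport_conv f g⟩ : C_c(G.Arr, ℂ))

theorem mul_apply (f g : G.Cc) (x : G.Arr) : (f * g) x =
    ∫ y, G.convIntegrand f g x y ∂(G.haar (G.src x)) := rfl

theorem ext {f g : G.Cc} (h : ∀ x, f x = g x) : f = g := DFunLike.ext _ _ h

theorem add_apply (f g : G.Cc) (x : G.Arr) : (f + g) x = f x + g x := rfl

theorem zero_apply (x : G.Arr) : (0 : G.Cc) x = 0 := rfl

instance : NonUnitalNonAssocRing G.Cc where
  left_distrib f g h := ext fun x => by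
    refine Eq.trans ?_
      (integral_add (G.integrable_convIntegrand f g x) (G.integrable_convIntegrand f h x))
    refine integral_congr_ae (Eventually.of_forall fun y => ?_)
    by_cases hy : G.src x = G.rng y
    · simp only [convIntegrand, hy, dite_true, add_apply]; ring
    · simp [convIntegrand, hy]
  right_distrib f g h := ext fun x => by
    refine Eq.trans ?_
      (integral_add (G.integrable_convIntegrand f h x) (G.integrable_convIntegrand g h x))
    refine integral_congr_ae (Eventually.of_forall fun y => ?_)
    by_cases hy : G.src x = G.rng y
    · simp only [convIntegrand, hy, dite_true, add_apply]; ring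
    · simp [convIntegrand, hy]
  zero_mul f := ext fun x => by
    rw [mul_apply]
    refine (integral_congr_ae (Eventually.of_forall fun y => ?_)).trans (integral_zero G.Arr ℂ)
    simp [convIntegrand, zero_apply]
  mul_zero f := ext fun x => by
    rw [mul_apply]
    refine (integral_congr_ae (Eventually.of_forall fun y => ?_)).trans (integral_zero G.Arr ℂ)
    simp [convIntegrand, zero_apply]

theorem continuous_star_aux (f : G.Cc) : Continuous fun x =>
    conj (f (G.inv x) * (G.cocycle x (G.inv x) (G.rng_inv x).symm : ℂ)) := by
  have h1 : Continuous fun x => f (G.inv x) :=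
    (ContinuousMap.continuous (CompactlySupportedContinuousMap.toContinuousMap f)).comp G.continuous_inv
  have h2 : Continuous fun x => (G.cocycle x (G.inv x) (G.rng_inv x).symm : ℂ) :=
    continuous_subtype_val.comp (G.continuous_cocycle.comp
      (f := fun x => (⟨(x, G.inv x), (G.rng_inv x).symm⟩ :
        {p : G.Arr × G.Arr // G.src p.1 = G.rng p.2}))
      (Continuous.subtype_mk (continuous_id.prodMk G.continuous_inv) _))
  exact Complex.continuous_conj.comp (h1.mul h2)

/-- The involution `f^*(x) = conj (f(x⁻¹) σ(x, x⁻¹))`. -/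
instance : Star G.Cc where
  star f := (⟨⟨fun x => conj (f (G.inv x) * (G.cocycle x (G.inv x) (G.rng_inv x).symm : ℂ)),
      continuous_star_aux f⟩,
    HasCompactSupport.intro (G.isCompact_inv_preimage
      (CompactlySupportedContinuousMap.hasCompactSupport' f)) fun x hx => by
        change conj (f (G.inv x) * _) = 0
        rw [show f (G.inv x) = 0 from image_eq_zero_of_notMem_tsupport hx]; simp⟩ :
    C_c(G.Arr, ℂ))

end Cc

/-! ## The maximal and the minimal (reduced) norm -/

/-- The `I`-norm on `C_c(G, σ)`. -/
def normI (f : G.Cc) : ℝ :=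
  max (⨆ u : G.Obj, ∫ x, ‖f x‖ ∂(G.haar u)) (⨆ u : G.Obj, ∫ x, ‖f (G.inv x)‖ ∂(G.haar u))

/-- The maximal norm: the supremum of `‖π(f)‖` over all `I`-norm continuous `*`-representations `π`
of `C_c(G, σ)` on Hilbert spaces. -/
def normMax (f : G.Cc) : ℝ :=
  sSup {c : ℝ | ∃ (E : Type u) (_ : NormedAddCommGroup E) (_ : InnerProductSpace ℂ E)
    (_ : CompleteSpace E) (π : G.Cc →⋆ₙₐ[ℂ] (E →L[ℂ] E)),
    (∃ C : ℝ, ∀ g, ‖π g‖ ≤ C * G.normI g) ∧ c = ‖π f‖}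

/-- The measure `μ_u` on the arrows with source `u`: the image of `μ^u` under inversion. -/
def haarInv (u : G.Obj) : Measure G.Arr := (G.haar u).map G.inv

/-- `π` is the representation `Ind(δ_u)` of `C_c(G, σ)` on `L²(G_u, μ_u)`,
`(π(f)ξ)(x) = ∫ f(xy) ξ(y⁻¹) σ(xy, y⁻¹) dμ^u(y)`. -/
def IsInd (u : G.Obj)
    (π : G.Cc →⋆ₙₐ[ℂ] (Lp ℂ 2 (G.haarInv u) →L[ℂ] Lp ℂ 2 (G.haarInv u))) : Prop :=
  ∀ (f : G.Cc) (ξ : Lp ℂ 2 (G.haarInv u)),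
    π f ξ =ᵐ[G.haarInv u] fun x => ∫ y, G.convIntegrand f ξ x y ∂(G.haar u)

/-- The minimal (reduced) norm: the supremum over the units `u` of `‖Ind(δ_u)(f)‖`. -/
def normMin (f : G.Cc) : ℝ :=
  sSup {c : ℝ | ∃ (u : G.Obj)
    (π : G.Cc →⋆ₙₐ[ℂ] (Lp ℂ 2 (G.haarInv u) →L[ℂ] Lp ℂ 2 (G.haarInv u))),
    G.IsInd u π ∧ c = ‖π f‖}

/-- `ι : C_c(G, σ) → A` exhibits the C*-algebra `A` as the completion of `C_c(G, σ)` in the norm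
`N`. -/
structure IsCompletion (N : G.Cc → ℝ) {A : CStarCat.{u}} (ι : G.Cc →⋆ₙₐ[ℂ] A) : Prop where
  injective : Function.Injective ι
  norm_eq : ∀ f, ‖ι f‖ = N f
  denseRange : DenseRange ι

end TwistedGroupoid

/-! ## Partial morphisms -/

theorem PFun.image_val_preimage_asSubtype {α β : Type*} (f : α →. β) (s : Set β) :
    Subtype.val '' (f.asSubtype ⁻¹' s) = f.preimage s := by
  rw [PFun.preimage_asSubtype, Subtype.image_preimage_coe]
  exact inter_eq_right.2 (f.preimage_subset_dom s)

theorem PFun.fn_congr {α β : Type*} (f : α →. β) {a b : α} (h : a = b) (ha : a ∈ f.Dom)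
    (hb : b ∈ f.Dom) : f.fn a ha = f.fn b hb := by
  subst h; rfl

/-- A partial morphism `(φ, K) : (G, σ_G) → (H, σ_H)`: a partial function on arrows, whose domain `K`
is an open subgroupoid of `G` (with the restricted Haar system and cocycle), and which is a proper
continuous functor on `K` preserving the Haar systems and the cocycles. -/
@[ext]
structure PartialMorphism (G H : TwistedGroupoid.{u}) where
  toPFun : G.Arr →. H.Arr
  isOpen_dom : IsOpen toPFun.Dom
  inv_mem : ∀ x ∈ toPFun.Dom, G.inv x ∈ toPFun.Dom
  mul_mem : ∀ x ∈ toPFun.Dom, ∀ y ∈ toPFun.Dom, ∀ h : G.src x = G.rng y,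
    G.mul x y h ∈ toPFun.Dom
  composable : ∀ x (hx : x ∈ toPFun.Dom) y (hy : y ∈ toPFun.Dom), G.src x = G.rng y →
    H.src (toPFun.fn x hx) = H.rng (toPFun.fn y hy)
  map_mul : ∀ x (hx : x ∈ toPFun.Dom) y (hy : y ∈ toPFun.Dom) (h : G.src x = G.rng y),
    toPFun.fn (G.mul x y h) (mul_mem x hx y hy h) =
      H.mul (toPFun.fn x hx) (toPFun.fn y hy) (composable x hx y hy h)
  isProperMap : IsProperMap toPFun.asSubtype
  /-- `φ_* (μ^u|_K) = ν^{φ(u)}` for every unit `u` of `K`. -/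
  map_haar : ∀ (u : G.Obj) (hu : G.one u ∈ toPFun.Dom) (B : Set H.Arr), MeasurableSet B →
    G.haar u (toPFun.preimage B) = H.haar (H.rng (toPFun.fn (G.one u) hu)) B
  map_cocycle : ∀ x (hx : x ∈ toPFun.Dom) y (hy : y ∈ toPFun.Dom) (h : G.src x = G.rng y),
    G.cocycle x y h = H.cocycle (toPFun.fn x hx) (toPFun.fn y hy) (composable x hx y hy h)

namespace PartialMorphism

variable {G H L : TwistedGroupoid.{u}}

theorem measurableSet_preimage (φ : PartialMorphism G H) {B : Set H.Arr} (hB : MeasurableSet B) :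
    MeasurableSet (φ.toPFun.preimage B) := by
  rw [← PFun.image_val_preimage_asSubtype]
  exact (MeasurableEmbedding.subtype_coe φ.isOpen_dom.measurableSet).measurableSet_image.2
    (φ.isProperMap.continuous.measurable hB)

theorem isOpen_preimage (φ : PartialMorphism G H) {B : Set H.Arr} (hB : IsOpen B) :
    IsOpen (φ.toPFun.preimage B) := by
  rw [← PFun.image_val_preimage_asSubtype]
  exact φ.isOpen_dom.isOpenMap_subtype_val _ (hB.preimage φ.isProperMap.continuous)

theorem isCompact_preimage (φ : PartialMorphism G H) {B : Set H.Arr} (hB : IsCompact B) :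
    IsCompact (φ.toPFun.preimage B) := by
  rw [← PFun.image_val_preimage_asSubtype]
  exact (φ.isProperMap.isCompact_preimage hB).image continuous_subtype_val

theorem fn_one (φ : PartialMorphism G H) {u : G.Obj} (hu : G.one u ∈ φ.toPFun.Dom) :
    φ.toPFun.fn (G.one u) hu = H.one (H.rng (φ.toPFun.fn (G.one u) hu)) := by
  have h : G.src (G.one u) = G.rng (G.one u) := (G.src_one u).trans (G.rng_one u).symm
  refine H.eq_one_of_mul_self _ (φ.composable _ hu _ hu h) ?_
  rw [← φ.map_mul _ hu _ hu h]
  congr 1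
  exact G.one_mul' _ h

theorem fn_inv (φ : PartialMorphism G H) {x : G.Arr} (hx : x ∈ φ.toPFun.Dom) :
    φ.toPFun.fn (G.inv x) (φ.inv_mem x hx) = H.inv (φ.toPFun.fn x hx) := by
  have h := φ.map_mul _ (φ.inv_mem x hx) _ hx (G.src_inv x)
  have h1 : G.one (G.src x) ∈ φ.toPFun.Dom := by
    rw [← G.inv_mul x]; exact φ.mul_mem _ (φ.inv_mem x hx) _ hx (G.src_inv x)
  rw [φ.toPFun.fn_congr (G.inv_mul x) _ h1, φ.fn_one] at h
  exact H.eq_inv_of_mul_eq_one _ h.symm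

/-- The identity partial morphism. -/
def id (G : TwistedGroupoid.{u}) : PartialMorphism G G where
  toPFun := PFun.id G.Arr
  isOpen_dom := isOpen_univ
  inv_mem _ _ := trivial
  mul_mem _ _ _ _ _ := trivial
  composable _ _ _ _ h := h
  map_mul _ _ _ _ _ := rfl
  isProperMap := (Homeomorph.Set.univ G.Arr).isProperMap
  map_haar u _ B _ := by
    have : (PFun.id G.Arr).preimage B = B := by
      rw [← PFun.coe_id, PFun.coe_preimage, preimage_id]
    rw [this]
    exact congrArg (fun v => G.haar v B) (G.rng_one u).symm
  map_cocycle _ _ _ _ _ := rfl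

/-- The composition `ψ ∘ φ|_A`, with domain `A` the preimage under `φ` of the domain of `ψ`. -/
def comp (ψ : PartialMorphism H L) (φ : PartialMorphism G H) : PartialMorphism G L where
  toPFun := ψ.toPFun.comp φ.toPFun
  isOpen_dom := by
    rw [PFun.dom_comp]; exact φ.isOpen_preimage ψ.isOpen_dom
  inv_mem := by
    rintro x ⟨hx, hx'⟩
    refine ⟨φ.inv_mem x hx, ?_⟩
    change φ.toPFun.fn _ _ ∈ ψ.toPFun.Dom
    rw [φ.fn_inv hx]
    exact ψ.inv_mem _ hx'
  mul_mem := by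
    rintro x ⟨hx, hx'⟩ y ⟨hy, hy'⟩ h
    refine ⟨φ.mul_mem x hx y hy h, ?_⟩
    change φ.toPFun.fn _ _ ∈ ψ.toPFun.Dom
    rw [φ.map_mul x hx y hy h]
    exact ψ.mul_mem _ hx' _ hy' _
  composable := by
    rintro x ⟨hx, hx'⟩ y ⟨hy, hy'⟩ h
    exact ψ.composable _ hx' _ hy' (φ.composable x hx y hy h)
  map_mul := by
    rintro x ⟨hx, hx'⟩ y ⟨hy, hy'⟩ h
    exact (ψ.toPFun.fn_congr (φ.map_mul x hx y hy h) _
      (ψ.mul_mem _ hx' _ hy' (φ.composable x hx y hy h))).trans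
        (ψ.map_mul _ hx' _ hy' (φ.composable x hx y hy h))
  isProperMap := by
    rw [isProperMap_iff_isCompact_preimage]
    constructor
    · exact ψ.isProperMap.continuous.comp (f := fun x : (ψ.toPFun.comp φ.toPFun).Dom =>
        (⟨φ.toPFun.asSubtype ⟨x.1, x.2.1⟩, x.2.2⟩ : ψ.toPFun.Dom))
        (Continuous.subtype_mk (φ.isProperMap.continuous.comp
          (Continuous.subtype_mk continuous_subtype_val _)) _)
    · intro K hK
      rw [IsEmbedding.subtypeVal.isCompact_iff, PFun.image_val_preimage_asSubtype,
        PFun.preimage_comp]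
      exact φ.isCompact_preimage (ψ.isCompact_preimage hK)
  map_haar := by
    rintro u ⟨hu, hu'⟩ B hB
    rw [PFun.preimage_comp, φ.map_haar u hu _ (ψ.measurableSet_preimage hB)]
    have h1 : H.one (H.rng (φ.toPFun.fn (G.one u) hu)) ∈ ψ.toPFun.Dom := by
      rw [← φ.fn_one hu]; exact hu'
    rw [ψ.map_haar _ h1 B hB, ψ.toPFun.fn_congr (φ.fn_one hu).symm h1 hu']
    rfl
  map_cocycle := by
    rintro x ⟨hx, hx'⟩ y ⟨hy, hy'⟩ h
    exact (φ.map_cocycle x hx y hy h).trans (ψ.map_cocycle _ hx' _ hy' _)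

end PartialMorphism

/-- The category of pairs `(G, σ)` and partial morphisms. -/
instance : Category TwistedGroupoid.{u} where
  Hom G H := PartialMorphism G H
  id G := PartialMorphism.id G
  comp φ ψ := PartialMorphism.comp ψ φ
  id_comp φ := PartialMorphism.ext (PFun.comp_id φ.toPFun)
  comp_id φ := PartialMorphism.ext (PFun.id_comp φ.toPFun)
  assoc φ ψ χ := PartialMorphism.ext (PFun.comp_assoc χ.toPFun ψ.toPFun φ.toPFun).symm

/-- The induced map `C_c(H, σ_H) → C_c(K, τ) → C_c(G, σ_G)` of a partial morphism `(φ, K)`: pull back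
along `φ`, then extend by zero outside `K`. -/
def PartialMorphism.induced {G H : TwistedGroupoid.{u}} (φ : PartialMorphism G H) (f : H.Cc) :
    G.Cc :=
  (⟨⟨fun x => open Classical in
      if hx : x ∈ φ.toPFun.Dom then f (φ.toPFun.fn x hx) else 0, by
      set F : G.Arr → ℂ := fun x => open Classical in
        if hx : x ∈ φ.toPFun.Dom then f (φ.toPFun.fn x hx) else 0 with hF
      have hK : IsCompact (φ.toPFun.preimage (tsupport f)) :=
        φ.isCompact_preimage (CompactlySupportedContinuousMap.hasCompactSupport' f)
      rw [continuous_iff_continuousAt]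
      intro x
      by_cases hx : x ∈ φ.toPFun.Dom
      · have hc : ContinuousOn F φ.toPFun.Dom := by
          rw [continuousOn_iff_continuous_domRestrict]
          have h1 : Continuous f :=
            ContinuousMap.continuous (CompactlySupportedContinuousMap.toContinuousMap f)
          refine (h1.comp φ.isProperMap.continuous).congr fun y => ?_
          change f (φ.toPFun.fn y y.2) = F y
          simp only [hF]
          rw [dif_pos y.2]
        exact hc.continuousAt (φ.isOpen_dom.mem_nhds hx)
      · have hev : ∀ᶠ y in 𝓝 x, F y = 0 := by
          filter_upwards [hK.isClosed.isOpen_compl.mem_nhds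
            fun h => hx (φ.toPFun.preimage_subset_dom _ h)] with y hy
          simp only [hF]
          split_ifs with hyd
          · by_contra hne
            exact hy ⟨_, subset_tsupport _ hne, Part.get_mem hyd⟩
          · rfl
        exact (continuousAt_const (y := (0 : ℂ))).congr
          (hev.mono fun y hy => hy.symm)⟩,
    HasCompactSupport.intro
      (φ.isCompact_preimage (CompactlySupportedContinuousMap.hasCompactSupport' f)) fun x hx => by
        change (open Classical in
          if hx : x ∈ φ.toPFun.Dom then f (φ.toPFun.fn x hx) else 0) = 0
        split_ifs with hxd
        · by_contra hne
          exact hx ⟨_, subset_tsupport _ hne, Part.get_mem hxd⟩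
        · rfl⟩ : C_c(G.Arr, ℂ))

/-! ## Locally compact spaces and the Gelfand duality functor -/

/-- A locally compact Hausdorff space. -/
structure LCSpace : Type (u + 1) where
  carrier : Type u
  [top : TopologicalSpace carrier]
  [t2 : T2Space carrier]
  [lc : LocallyCompactSpace carrier]

namespace LCSpace

instance : CoeSort LCSpace.{u} (Type u) := ⟨carrier⟩

attribute [instance] LCSpace.top LCSpace.t2 LCSpace.lc

/-- Proper continuous maps. -/
@[ext]
structure Hom (X Y : LCSpace.{u}) where
  toFun : X → Y
  isProperMap : IsProperMap toFun

/-- The category of locally compact Hausdorff spaces and proper continuous maps. -/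
instance : Category LCSpace.{u} where
  Hom X Y := Hom X Y
  id X := ⟨fun x => x, isProperMap_id⟩
  comp f g := ⟨g.toFun ∘ f.toFun, g.isProperMap.comp f.isProperMap⟩

theorem regular_dirac {X : Type*} [TopologicalSpace X] [T2Space X] [MeasurableSpace X]
    [BorelSpace X] (x : X) : (Measure.dirac x).Regular where
  lt_top_of_isCompact _ _ := measure_lt_top _ _
  outerRegular A hA r hr := by
    by_cases hx : x ∈ A
    · exact ⟨univ, subset_univ _, isOpen_univ, by simpa [hx] using hr⟩
    · refine ⟨{x}ᶜ, fun y hy h => hx (h ▸ hy), isOpen_compl_singleton, ?_⟩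
      rw [Measure.dirac_apply' _ hA, indicator_of_notMem hx] at hr
      simpa using hr
  innerRegular U hU r hr := by
    rw [Measure.dirac_apply' _ hU.measurableSet] at hr
    by_cases hx : x ∈ U
    · exact ⟨{x}, by simpa using hx, isCompact_singleton, by simpa [hx] using hr⟩
    · simp [hx] at hr

theorem dirac_preimage {X Y : Type*} [TopologicalSpace X] [TopologicalSpace Y] {f : X → Y}
    (hf : Continuous f) (x : X) (B : Set Y) (hB : MeasurableSet[borel Y] B) :
    @Measure.dirac X (borel X) x (f ⁻¹' B) = @Measure.dirac Y (borel Y) (f x) B := by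
  let _ : MeasurableSpace X := borel X
  let _ : MeasurableSpace Y := borel Y
  have : BorelSpace X := ⟨rfl⟩
  have : BorelSpace Y := ⟨rfl⟩
  rw [Measure.dirac_apply' _ (hf.measurable hB), Measure.dirac_apply' _ hB]
  rfl

/-- A locally compact Hausdorff space as a groupoid all of whose arrows are units, with the point
masses as Haar system and with the trivial cocycle. -/
def toTwistedGroupoid (X : LCSpace.{u}) : TwistedGroupoid.{u} :=
  letI : MeasurableSpace X := borel X
  haveI : BorelSpace X := ⟨rfl⟩
  { Obj := X
    Arr := X
    src := fun x => x
    rng := fun x => x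
    one := fun x => x
    inv := fun x => x
    mul := fun x _ _ => x
    src_one := fun _ => rfl
    rng_one := fun _ => rfl
    src_inv := fun _ => rfl
    rng_inv := fun _ => rfl
    src_mul := fun _ _ h => h
    rng_mul := fun _ _ _ => rfl
    mul_assoc := fun _ _ _ _ _ => rfl
    one_mul := fun _ => rfl
    mul_one := fun _ => rfl
    inv_mul := fun _ => rfl
    mul_inv := fun _ => rfl
    continuous_src := continuous_id
    continuous_rng := continuous_id
    continuous_one := continuous_id
    continuous_inv := continuous_id
    continuous_mul := continuous_fst.comp continuous_subtype_val
    haar := fun x => Measure.dirac x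
    haar_regular := fun x => regular_dirac x
    haar_support := fun x => by
      ext y
      rw [Measure.mem_support_iff_forall]
      constructor
      · intro h
        by_contra hne
        have := h {x}ᶜ (isOpen_compl_singleton.mem_nhds hne)
        simp at this
      · rintro rfl U hU
        exact lt_of_lt_of_le (by simp [mem_of_mem_nhds hU]) (Measure.le_dirac_apply (a := y))
    haar_continuous := fun f => by
      simpa using f.continuous
    haar_invariant := fun x f => by
      simp
    cocycle := fun _ _ _ => 1
    continuous_cocycle := continuous_const
    cocycle_identity := fun _ _ _ _ _ => rfl
    cocycle_one := fun _ => rfl }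

/-- The functor viewing spaces as groupoids and proper continuous maps as (everywhere defined)
partial morphisms. -/
def toGroupoids : LCSpace.{u} ⥤ TwistedGroupoid.{u} where
  obj X := X.toTwistedGroupoid
  map {X Y} f :=
    { toPFun := PFun.lift f.toFun
      isOpen_dom := isOpen_univ
      inv_mem := fun _ _ => trivial
      mul_mem := fun _ _ _ _ _ => trivial
      composable := fun _ _ _ _ h => congrArg f.toFun h
      map_mul := fun _ _ _ _ _ => rfl
      isProperMap := f.isProperMap.comp (Homeomorph.Set.univ X).isProperMap
      map_haar := fun u _ B hB => by
        have hpre : PFun.preimage (PFun.lift f.toFun) B = f.toFun ⁻¹' B :=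
          PFun.coe_preimage (α := X.carrier) (β := Y.carrier) f.toFun B
        refine (congrArg (X.toTwistedGroupoid.haar u) hpre).trans ?_
        exact dirac_preimage f.isProperMap.continuous u B hB
      map_cocycle := fun _ _ _ _ _ => rfl }
  map_id X := PartialMorphism.ext (PFun.coe_id X.carrier)
  map_comp f g := PartialMorphism.ext (PFun.coe_comp g.toFun f.toFun)

/-- The Gelfand duality functor: `X ↦ C₀(X)`, and `f ↦ f^*`, pulling back along `f`. -/
def gelfand : LCSpace.{u}ᵒᵖ ⥤ CStarCat.{u} where
  obj X := ⟨C₀(X.unop, ℂ)⟩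
  map {X Y} f := ⟨
    { toFun := fun g => g.comp ⟨⟨f.unop.toFun, f.unop.isProperMap.continuous⟩,
        (isProperMap_iff_tendsto_cocompact.1 f.unop.isProperMap).2⟩
      map_smul' := fun _ _ => rfl
      map_zero' := rfl
      map_add' := fun _ _ => rfl
      map_mul' := fun _ _ => rfl
      map_star' := fun _ => rfl }⟩

/-- The inclusion of `C_c(X)` in `C₀(X)`. -/
def toC₀ (X : LCSpace.{u}) (f : X.toTwistedGroupoid.Cc) : C₀(X, ℂ) where
  toFun := f
  continuous_toFun := ContinuousMap.continuous (CompactlySupportedContinuousMap.toContinuousMap f)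
  zero_at_infty' := (CompactlySupportedContinuousMap.hasCompactSupport' f).is_zero_at_infty

end LCSpace

end

/-! ### Completions of `C_c(G, σ)` and extension of homomorphisms to them -/

namespace TwistedGroupoid

open scoped ENNReal

/-! A norm on the algebras `C_c(G, σ)` defines a functor of the required kind as soon as it has a
C*-completion, is not increased by any induced map φ^*, and is the supremum norm on spaces
(`exists_functor`): each φ^* then extends by continuity, and functoriality and naturality need only
be checked on the dense subalgebras. The work lies in these three properties.

Algebra and completions. Writing x = a⁻¹, convolution by f becomes an integral operator on each
range fibre G^u, with kernel k_f(a, y) = f(a⁻¹y) σ(a⁻¹y, y⁻¹). Left invariance and the cocycle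
identity show that convolution composes kernels (`ker_mul`) and that the involution gives adjoint
kernels (`ker_star`); Fubini then yields associativity and the adjoint relation, and the Schur test
bounds Ind(δ_u) by the I-norm. As μ^u has support G^u, these representations are jointly faithful.
The C*-identity makes every I-continuous representation contractive for the I-norm
(`norm_le_normI`), so the maximal norm is finite. Both completions are closures of `C_c(G, σ)` in a
bounded product of operator algebras.

Contractivity of φ^*. Since φ carries μ^u to ν^{φ(u)} and matches the cocycles, φ^* is a
`*`-homomorphism that does not increase the I-norm. Hence I-continuous representations pull back,
which settles the maximal norm. For the minimal norm no intertwiner between the spaces L²(G_u) and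
L²(H_v) is used; growth of powers replaces it. Put F = f^* * f and let M be the square of the
minimal norm of f. The operator T = Ind(δ_u)(φ^*F) is self-adjoint and T^{n+1} g = φ^*(F^{n+1}) * g.
The L²-norm of the right side is at most the fibrewise L¹-norm of g times the supremum over v of the
norm of F^{n+1} in L²(H_v), which is O(M^n). A self-adjoint operator with such growth on a dense set
has norm at most M (`IsSelfAdjoint.norm_le_of_pow_le`).

Spaces. There, sup norm ≤ minimal norm ≤ maximal norm ≤ I-norm ≤ sup norm, so all agree. -/

theorem exists_hom_extension {G : TwistedGroupoid.{u}} {A B : CStarCat.{u}}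
    (ι : G.Cc →⋆ₙₐ[ℂ] A) (κ : G.Cc →⋆ₙₐ[ℂ] B) (hd : DenseRange ι)
    (h : ∀ f, ‖κ f‖ ≤ ‖ι f‖) : ∃ F : A →⋆ₙₐ[ℂ] B, ∀ f, F (ι f) = κ f := by
  let i : G.Cc →ₗ[ℂ] A := { toFun := ι, map_add' := map_add ι, map_smul' := map_smul ι }
  let k : G.Cc →ₗ[ℂ] B := { toFun := κ, map_add' := map_add κ, map_smul' := map_smul κ }
  have hb : ∃ C : ℝ, ∀ x, ‖k x‖ ≤ C * ‖i x‖ := ⟨1, fun f => by rw [one_mul]; exact h f⟩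
  set T : A →L[ℂ] B := k.extendOfNorm i with hT
  have hTi : ∀ f, T (ι f) = κ f := fun f => LinearMap.extendOfNorm_eq (e := i) hd hb f
  refine ⟨{ toFun := T, map_add' := map_add T, map_smul' := map_smul T, map_zero' := map_zero T,
            map_mul' := fun x y => ?_, map_star' := fun x => ?_ }, hTi⟩
  · refine hd.induction_on₂ (p := fun x y => T (x * y) = T x * T y) ?_ ?_ x y
    · exact isClosed_eq (by fun_prop) (by fun_prop)
    · intro f g
      rw [← map_mul, hTi, hTi, hTi, map_mul]
  · refine hd.induction_on (p := fun x => T (star x) = star (T x)) x ?_ ?_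
    · exact isClosed_eq (T.continuous.comp continuous_star) (continuous_star.comp T.continuous)
    · intro f
      rw [← map_star, hTi, hTi, map_star]

/-- A `*`-homomorphism between C*-algebras is automatically contractive, so it is determined by its
values on a dense set. -/
theorem _root_.CStarCat.hom_ext_of_denseRange {G : TwistedGroupoid.{u}} {A B : CStarCat.{u}}
    {ι : G.Cc → A} (hd : DenseRange ι) {F F' : A ⟶ B}
    (h : ∀ f, F.hom (ι f) = F'.hom (ι f)) : F = F' := by
  have hc (T : A →⋆ₙₐ[ℂ] B) : Continuous T :=
    AddMonoidHomClass.continuous_of_bound T 1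
      (by simpa only [one_mul] using NonUnitalStarAlgHom.norm_apply_le T)
  refine CStarCat.Hom.ext (NonUnitalStarAlgHom.ext fun x => ?_)
  exact congrFun (DenseRange.equalizer hd (hc F.hom) (hc F'.hom)
    (funext h)) x

/-- Two completions in the same norm are isomorphic. -/
theorem IsCompletion.exists_iso {G : TwistedGroupoid.{u}} {N : G.Cc → ℝ} {A B : CStarCat.{u}}
    {ι : G.Cc →⋆ₙₐ[ℂ] A} {κ : G.Cc →⋆ₙₐ[ℂ] B} (hι : G.IsCompletion N ι)
    (hκ : G.IsCompletion N κ) : ∃ e : A ≅ B, ∀ f, e.hom.hom (ι f) = κ f := by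
  obtain ⟨F, hF⟩ := exists_hom_extension ι κ hι.denseRange
    fun f => (hκ.norm_eq f).trans_le (hι.norm_eq f).ge
  obtain ⟨F', hF'⟩ := exists_hom_extension κ ι hκ.denseRange
    fun f => (hι.norm_eq f).trans_le (hκ.norm_eq f).ge
  refine ⟨⟨⟨F⟩, ⟨F'⟩, ?_, ?_⟩, hF⟩
  · refine CStarCat.hom_ext_of_denseRange hι.denseRange fun f => ?_
    change F' (F (ι f)) = ι f
    rw [hF, hF']
  · refine CStarCat.hom_ext_of_denseRange hκ.denseRange fun f => ?_
    change F (F' (κ f)) = κ f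
    rw [hF', hF]

/-- A bounded, jointly injective family of `*`-homomorphisms into C*-algebras gives a completion in
the supremum of the norms. -/
theorem exists_isCompletion {G : TwistedGroupoid.{u}} {N : G.Cc → ℝ} {I : Type u}
    (B : I → Type u) [∀ i, NonUnitalCStarAlgebra (B i)] (φ : ∀ i, G.Cc →⋆ₙₐ[ℂ] B i)
    (hN : ∀ f, N f = ⨆ i, ‖φ i f‖) (hbdd : ∀ f, BddAbove (range fun i => ‖φ i f‖))
    (hinj : ∀ f, (∀ i, φ i f = 0) → f = 0) :
    ∃ (A : CStarCat.{u}) (ι : G.Cc →⋆ₙₐ[ℂ] A), G.IsCompletion N ι := by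
  have hmem : ∀ f, Memℓp (fun i => φ i f) ∞ := fun f => memℓp_infty (hbdd f)
  let Φ : G.Cc →⋆ₙₐ[ℂ] lp B ∞ :=
    { toFun := fun f => ⟨fun i => φ i f, hmem f⟩
      map_add' := fun f g => lp.ext (funext fun i => map_add (φ i) f g)
      map_smul' := fun c f => lp.ext (funext fun i => map_smul (φ i) c f)
      map_zero' := lp.ext (funext fun i => map_zero (φ i))
      map_mul' := fun f g => lp.ext (funext fun i => map_mul (φ i) f g)
      map_star' := fun f => lp.ext (funext fun i => map_star (φ i) f) }
  -- The completion is the closure of the diagonal image in the ℓ^∞-product, whose norm is the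
  -- supremum of the coordinate norms.
  let S : NonUnitalStarSubalgebra ℂ (lp B ∞) :=
    (NonUnitalStarAlgHom.range Φ).topologicalClosure
  have hS : IsClosed (S : Set (lp B ∞)) :=
    NonUnitalStarSubalgebra.isClosed_topologicalClosure _
  let _ : NonUnitalCStarAlgebra S := NonUnitalStarSubalgebra.nonUnitalCStarAlgebra S (h_closed := hS)
  have hmS : ∀ f, Φ f ∈ S := fun f =>
    NonUnitalStarSubalgebra.le_topologicalClosure _ (NonUnitalStarAlgHom.mem_range_self Φ f)
  let ι : G.Cc →⋆ₙₐ[ℂ] S := NonUnitalStarAlgHom.codRestrict Φ S hmS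
  refine ⟨⟨S⟩, ι, ?_, ?_, ?_⟩
  · refine (injective_iff_map_eq_zero ι).2 fun f hf => hinj f fun i => ?_
    have h1 : Φ f = 0 := congrArg Subtype.val hf
    exact congrFun (congrArg Subtype.val h1) i
  · intro f
    rw [hN]
    exact lp.norm_eq_ciSup (Φ f)
  · intro x
    rw [closure_subtype]
    have hx : (x : lp B ∞) ∈ closure (range Φ) := x.2
    convert hx using 2
    ext y
    simp only [mem_image, mem_range]
    constructor
    · rintro ⟨_, ⟨f, rfl⟩, rfl⟩; exact ⟨f, rfl⟩
    · rintro ⟨f, rfl⟩; exact ⟨_, ⟨f, rfl⟩, rfl⟩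

end TwistedGroupoid

/-! ### Functoriality of the induced map on compactly supported functions -/

namespace PartialMorphism

variable {G H L : TwistedGroupoid.{u}}

theorem induced_of_mem (φ : PartialMorphism G H) (f : H.Cc) {x : G.Arr}
    (hx : x ∈ φ.toPFun.Dom) : φ.induced f x = f (φ.toPFun.fn x hx) :=
  dif_pos hx

theorem induced_of_notMem (φ : PartialMorphism G H) (f : H.Cc) {x : G.Arr}
    (hx : x ∉ φ.toPFun.Dom) : φ.induced f x = 0 :=
  dif_neg hx

theorem induced_id (f : G.Cc) : (PartialMorphism.id G).induced f = f :=
  TwistedGroupoid.Cc.ext fun _ => induced_of_mem (PartialMorphism.id G) f trivial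

/-- The domain of ψ ∘ φ is φ⁻¹(dom ψ); off it, one of the two successive extensions by zero already
gives zero. -/
theorem induced_comp (ψ : PartialMorphism H L) (φ : PartialMorphism G H) (f : L.Cc) :
    (ψ.comp φ).induced f = φ.induced (ψ.induced f) := by
  refine TwistedGroupoid.Cc.ext fun x => ?_
  by_cases hx : x ∈ φ.toPFun.Dom
  · rw [induced_of_mem φ _ hx]
    by_cases hx' : φ.toPFun.fn x hx ∈ ψ.toPFun.Dom
    · rw [induced_of_mem ψ _ hx', induced_of_mem (ψ.comp φ) f (show x ∈ _ from ⟨hx, hx'⟩)]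
      rfl
    · rw [induced_of_notMem ψ _ hx', induced_of_notMem]
      rintro ⟨h1, h2⟩
      exact hx' h2
  · rw [induced_of_notMem φ _ hx, induced_of_notMem]
    rintro ⟨h1, h2⟩
    exact hx h1

end PartialMorphism

/-! ### Groupoid calculus with a total product; invariance and Fubini on fibres -/

namespace HaarGroupoid

variable (G : HaarGroupoid.{u})

open Classical in
/-- Multiplication as a total operation (with a junk value off the composable pairs). -/
noncomputable def tmul (x y : G.Arr) : G.Arr :=
  if h : G.src x = G.rng y then G.mul x y h else x

variable {G}

theorem tmul_eq {x y : G.Arr} (h : G.src x = G.rng y) : G.tmul x y = G.mul x y h :=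
  dif_pos h

theorem src_tmul {x y : G.Arr} (h : G.src x = G.rng y) : G.src (G.tmul x y) = G.src y := by
  rw [tmul_eq h, G.src_mul]

theorem rng_tmul {x y : G.Arr} (h : G.src x = G.rng y) : G.rng (G.tmul x y) = G.rng x := by
  rw [tmul_eq h, G.rng_mul]

theorem tmul_assoc {x y z : G.Arr} (hxy : G.src x = G.rng y) (hyz : G.src y = G.rng z) :
    G.tmul (G.tmul x y) z = G.tmul x (G.tmul y z) := by
  rw [tmul_eq ((src_tmul hxy).trans hyz), tmul_eq (hxy.trans (rng_tmul hyz).symm)]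
  have := G.mul_assoc x y z hxy hyz
  rw [G.mul_congr (tmul_eq hxy) rfl, this]
  exact G.mul_congr rfl (tmul_eq hyz).symm _

theorem inv_tmul_self (x : G.Arr) : G.tmul (G.inv x) x = G.one (G.src x) := by
  rw [tmul_eq (G.src_inv x), G.inv_mul]

theorem tmul_inv_self (x : G.Arr) : G.tmul x (G.inv x) = G.one (G.rng x) := by
  rw [tmul_eq (G.rng_inv x).symm, G.mul_inv]

theorem one_tmul {u : G.Obj} {x : G.Arr} (h : G.rng x = u) : G.tmul (G.one u) x = x := by
  rw [tmul_eq ((G.src_one u).trans h.symm), G.one_mul']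

theorem tmul_one {u : G.Obj} {x : G.Arr} (h : G.src x = u) : G.tmul x (G.one u) = x := by
  rw [tmul_eq (h.trans (G.rng_one u).symm), G.mul_one']

theorem inv_tmul_tmul {x y : G.Arr} (h : G.src x = G.rng y) :
    G.tmul (G.inv x) (G.tmul x y) = y := by
  rw [← tmul_assoc (G.src_inv x) h, inv_tmul_self, one_tmul h.symm]

theorem tmul_inv_tmul {x y : G.Arr} (h : G.rng x = G.rng y) :
    G.tmul x (G.tmul (G.inv x) y) = y := by
  rw [← tmul_assoc (G.rng_inv x).symm ((G.src_inv x).trans h), tmul_inv_self, one_tmul h.symm]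

theorem inv_tmul {x y : G.Arr} (h : G.src x = G.rng y) :
    G.inv (G.tmul x y) = G.tmul (G.inv y) (G.inv x) := by
  have h1 : G.src (G.inv y) = G.rng (G.inv x) := by rw [G.src_inv, G.rng_inv, h]
  have h2 : G.src (G.tmul (G.inv y) (G.inv x)) = G.rng (G.tmul x y) := by
    rw [src_tmul h1, rng_tmul h, G.src_inv]
  refine (G.eq_inv_of_mul_eq_one (u := G.src y) h2 ?_).symm
  rw [← tmul_eq h2, tmul_assoc h1 ((G.src_inv x).trans (rng_tmul h).symm), inv_tmul_tmul h,
    inv_tmul_self]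

theorem tmul_tmul_inv {x y : G.Arr} (h : G.src x = G.rng y) :
    G.tmul (G.tmul x y) (G.inv y) = x := by
  rw [tmul_assoc h (G.rng_inv y).symm, tmul_inv_self, tmul_one h]

variable (G)

theorem inv_one (u : G.Obj) : G.inv (G.one u) = G.one u := by
  have h : G.src (G.one u) = G.rng (G.one u) := (G.src_one u).trans (G.rng_one u).symm
  exact (G.eq_inv_of_mul_eq_one (u := u) h (G.one_mul' _ h)).symm

theorem continuousOn_tmul :
    ContinuousOn (fun p : G.Arr × G.Arr => G.tmul p.1 p.2) {p | G.src p.1 = G.rng p.2} := by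
  rw [continuousOn_iff_continuous_domRestrict]
  exact G.continuous_mul.congr fun p => (tmul_eq p.2).symm

theorem continuousOn_inv_tmul :
    ContinuousOn (fun p : G.Arr × G.Arr => G.tmul (G.inv p.1) p.2) {p | G.rng p.1 = G.rng p.2} :=
  G.continuousOn_tmul.comp (f := fun p : G.Arr × G.Arr => (G.inv p.1, p.2))
    ((G.continuous_inv.comp continuous_fst).prodMk continuous_snd).continuousOn
    fun p (hp : G.rng p.1 = G.rng p.2) => (G.src_inv p.1).trans hp

/-- Inversion as a homeomorphism. -/
def invHomeomorph : G.Arr ≃ₜ G.Arr where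
  toFun := G.inv
  invFun := G.inv
  left_inv := G.inv_inv
  right_inv := G.inv_inv
  continuous_toFun := G.continuous_inv
  continuous_invFun := G.continuous_inv

/-- Products of arrows from two compact sets lie in a compact set. -/
theorem exists_compact_tmul {A B : Set G.Arr} (hA : IsCompact A) (hB : IsCompact B) :
    ∃ C : Set G.Arr, IsCompact C ∧
      ∀ x ∈ A, ∀ y ∈ B, G.src x = G.rng y → G.tmul x y ∈ C := by
  have := G.t2_obj
  have hcl : IsClosed {p : G.Arr × G.Arr | G.src p.1 = G.rng p.2} :=
    isClosed_eq (G.continuous_src.comp continuous_fst) (G.continuous_rng.comp continuous_snd)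
  exact ⟨_, ((hA.prod hB).inter_right hcl).image_of_continuousOn
    (G.continuousOn_tmul.mono inter_subset_right), fun x hx y hy h => ⟨(x, y), ⟨⟨hx, hy⟩, h⟩, rfl⟩⟩

/-- Left invariance for fibrewise continuous, fibrewise compactly supported functions. -/
theorem integral_translate (z : G.Arr) {F : G.Arr → ℂ}
    (hF : ContinuousOn F {y | G.rng y = G.src z}) {K : Set G.Arr} (hK : IsCompact K)
    (hz : ∀ y, G.rng y = G.src z → y ∉ K → F y = 0) :
    ∫ y, F (G.tmul (G.inv z) y) ∂(G.haar (G.rng z)) = ∫ y, F y ∂(G.haar (G.src z)) := by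
  -- The axiom concerns functions in `C_c` of the whole arrow space, so F is replaced by such a
  -- function with the same values on the fibre.
  obtain ⟨g, hg⟩ := exists_compactlySupported_eqOn (G.isClosed_fiber (G.src z)) hF hK
    fun y hy hyK => hz y hy hyK
  -- Invariance is used at z⁻¹, which exchanges range and source.
  have h : ∫ y, g y ∂(G.haar (G.rng (G.inv z))) =
      ∫ y, g (G.tmul (G.inv z) y) ∂(G.haar (G.src (G.inv z))) := by
    refine (G.haar_invariant (G.inv z) g).trans (integral_congr_ae ?_)
    filter_upwards [G.ae_rng (G.src (G.inv z))] with y hy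
    rw [dif_pos hy.symm, tmul_eq hy.symm]
  rw [G.rng_inv, G.src_inv] at h
  have h1 : ∫ y, F y ∂(G.haar (G.src z)) = ∫ y, g y ∂(G.haar (G.src z)) := by
    refine integral_congr_ae ?_
    filter_upwards [G.ae_rng (G.src z)] with y hy using (hg hy).symm
  rw [h1, h]
  refine integral_congr_ae ?_
  filter_upwards [G.ae_rng (G.rng z)] with y hy
  have hzy : G.src (G.inv z) = G.rng y := (G.src_inv z).trans hy.symm
  exact (hg ((rng_tmul hzy).trans (G.rng_inv z))).symm

theorem integral_translate_real (z : G.Arr) {F : G.Arr → ℝ}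
    (hF : ContinuousOn F {y | G.rng y = G.src z}) {K : Set G.Arr} (hK : IsCompact K)
    (hz : ∀ y, G.rng y = G.src z → y ∉ K → F y = 0) :
    ∫ y, F (G.tmul (G.inv z) y) ∂(G.haar (G.rng z)) = ∫ y, F y ∂(G.haar (G.src z)) := by
  have h := G.integral_translate z (F := fun y => (F y : ℂ))
    (Complex.continuous_ofReal.comp_continuousOn hF) hK fun y hy hyK => by simp [hz y hy hyK]
  rw [integral_complex_ofReal, integral_complex_ofReal] at h
  exact Complex.ofReal_injective h

section Fubini

variable {u v : G.Obj} {F : G.Arr → G.Arr → ℂ} {K : Set (G.Arr × G.Arr)}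

/-- The integrands below are continuous only on a product of two fibres. The integrals see nothing
else, so F may be replaced there by a function in `C_c` of the product space. -/
theorem exists_compactlySupported_prod
    (hF : ContinuousOn (fun p : G.Arr × G.Arr => F p.1 p.2) {p | G.rng p.1 = u ∧ G.rng p.2 = v})
    (hK : IsCompact K) (hz : ∀ a y, G.rng a = u → G.rng y = v → (a, y) ∉ K → F a y = 0) :
    ∃ g : C_c(G.Arr × G.Arr, ℂ), ∀ a y, G.rng a = u → G.rng y = v → F a y = g (a, y) := by
  have := G.t2_obj
  obtain ⟨g, hg⟩ := exists_compactlySupported_eqOn (X := G.Arr × G.Arr)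
    (S := {p | G.rng p.1 = u ∧ G.rng p.2 = v})
    ((isClosed_eq (G.continuous_rng.comp continuous_fst) continuous_const).inter
      (isClosed_eq (G.continuous_rng.comp continuous_snd) continuous_const)) hF hK
    fun p hp hpK => hz p.1 p.2 hp.1 hp.2 hpK
  exact ⟨g, fun a y ha hy => (hg (show (a, y) ∈ _ from ⟨ha, hy⟩)).symm⟩

/-- Haar measures need not be σ-finite, so the interchange rests on Fubini for compactly supported
continuous functions. -/
theorem integral_fiber_integral_fiber_swap
    (hF : ContinuousOn (fun p : G.Arr × G.Arr => F p.1 p.2) {p | G.rng p.1 = u ∧ G.rng p.2 = v})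
    (hK : IsCompact K) (hz : ∀ a y, G.rng a = u → G.rng y = v → (a, y) ∉ K → F a y = 0) :
    ∫ a, ∫ y, F a y ∂(G.haar v) ∂(G.haar u) = ∫ y, ∫ a, F a y ∂(G.haar u) ∂(G.haar v) := by
  obtain ⟨g, hg⟩ := G.exists_compactlySupported_prod hF hK hz
  have h := integral_integral_swap_of_hasCompactSupport (μ := G.haar u) (ν := G.haar v)
    (f := fun a y => g (a, y)) g.continuous g.hasCompactSupport
  refine Eq.trans ?_ (h.trans ?_)
  · refine integral_congr_ae ?_
    filter_upwards [G.ae_rng u] with a ha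
    refine integral_congr_ae ?_
    filter_upwards [G.ae_rng v] with y hy using hg a y ha hy
  · refine integral_congr_ae ?_
    filter_upwards [G.ae_rng v] with y hy
    refine integral_congr_ae ?_
    filter_upwards [G.ae_rng u] with a ha using (hg a y ha hy).symm

theorem integrable_fiber_prod
    (hF : ContinuousOn (fun p : G.Arr × G.Arr => F p.1 p.2) {p | G.rng p.1 = u ∧ G.rng p.2 = v})
    (hK : IsCompact K) (hz : ∀ a y, G.rng a = u → G.rng y = v → (a, y) ∉ K → F a y = 0)
    {a : G.Arr} (ha : G.rng a = u) : Integrable (F a) (G.haar v) := by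
  obtain ⟨g, hg⟩ := G.exists_compactlySupported_prod hF hK hz
  have hc : Continuous fun y => g (a, y) := by fun_prop
  have hs : HasCompactSupport fun y => g (a, y) :=
    HasCompactSupport.intro (g.hasCompactSupport.isCompact.image continuous_snd) fun y hy => by
      by_contra hne
      exact hy ⟨(a, y), subset_tsupport _ hne, rfl⟩
  refine (hc.integrable_of_hasCompactSupport hs).congr ?_
  filter_upwards [G.ae_rng v] with y hy using (hg a y ha hy).symm

theorem integrable_integral_fiber
    (hF : ContinuousOn (fun p : G.Arr × G.Arr => F p.1 p.2) {p | G.rng p.1 = u ∧ G.rng p.2 = v})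
    (hK : IsCompact K) (hz : ∀ a y, G.rng a = u → G.rng y = v → (a, y) ∉ K → F a y = 0) :
    Integrable (fun a => ∫ y, F a y ∂(G.haar v)) (G.haar u) := by
  obtain ⟨g, hg⟩ := G.exists_compactlySupported_prod hF hK hz
  have hc : Continuous fun a => ∫ y, g (a, y) ∂(G.haar v) := by
    rw [← continuousOn_univ]
    exact continuousOn_integral_of_compact_support
      (f := fun a y => g (a, y)) (g.hasCompactSupport.isCompact.image continuous_snd)
      g.continuous.continuousOn fun a y _ hy => by
        by_contra hne
        exact hy ⟨(a, y), subset_tsupport _ hne, rfl⟩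
  have hs : HasCompactSupport fun a => ∫ y, g (a, y) ∂(G.haar v) :=
    HasCompactSupport.intro (g.hasCompactSupport.isCompact.image continuous_fst) fun a ha => by
      have : ∀ y, g (a, y) = 0 := fun y => by
        by_contra hne
        exact ha ⟨(a, y), subset_tsupport _ hne, rfl⟩
      simp [this]
  refine (hc.integrable_of_hasCompactSupport hs).congr ?_
  filter_upwards [G.ae_rng u] with a ha
  refine integral_congr_ae ?_
  filter_upwards [G.ae_rng v] with y hy using (hg a y ha hy).symm

end Fubini

section RealFubini

variable {u v : G.Obj} {F : G.Arr → G.Arr → ℝ} {K : Set (G.Arr × G.Arr)}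

theorem integral_fiber_integral_fiber_swap_real
    (hF : ContinuousOn (fun p : G.Arr × G.Arr => F p.1 p.2) {p | G.rng p.1 = u ∧ G.rng p.2 = v})
    (hK : IsCompact K) (hz : ∀ a y, G.rng a = u → G.rng y = v → (a, y) ∉ K → F a y = 0) :
    ∫ a, ∫ y, F a y ∂(G.haar v) ∂(G.haar u) = ∫ y, ∫ a, F a y ∂(G.haar u) ∂(G.haar v) := by
  have h := G.integral_fiber_integral_fiber_swap (u := u) (v := v) (F := fun a y => (F a y : ℂ))
    (Complex.continuous_ofReal.comp_continuousOn hF) hK fun a y ha hy h => by simp [hz a y ha hy h]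
  simp only [integral_complex_ofReal] at h
  exact Complex.ofReal_injective h

theorem integrable_fiber_prod_real
    (hF : ContinuousOn (fun p : G.Arr × G.Arr => F p.1 p.2) {p | G.rng p.1 = u ∧ G.rng p.2 = v})
    (hK : IsCompact K) (hz : ∀ a y, G.rng a = u → G.rng y = v → (a, y) ∉ K → F a y = 0)
    {a : G.Arr} (ha : G.rng a = u) : Integrable (F a) (G.haar v) :=
  (G.integrable_fiber_prod (F := fun a y => (F a y : ℂ))
    (Complex.continuous_ofReal.comp_continuousOn hF) hK
    (fun a y ha hy h => by simp [hz a y ha hy h]) ha).re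

theorem integrable_integral_fiber_real
    (hF : ContinuousOn (fun p : G.Arr × G.Arr => F p.1 p.2) {p | G.rng p.1 = u ∧ G.rng p.2 = v})
    (hK : IsCompact K) (hz : ∀ a y, G.rng a = u → G.rng y = v → (a, y) ∉ K → F a y = 0) :
    Integrable (fun a => ∫ y, F a y ∂(G.haar v)) (G.haar u) := by
  have h := (G.integrable_integral_fiber (u := u) (v := v) (F := fun a y => (F a y : ℂ))
    (Complex.continuous_ofReal.comp_continuousOn hF) hK
    (fun a y ha hy h => by simp [hz a y ha hy h])).re
  simp only [integral_complex_ofReal] at h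
  exact h

end RealFubini

end HaarGroupoid

/-! ### The cocycle as a total function, and convolution kernels -/

namespace TwistedGroupoid

open HaarGroupoid (tmul_eq src_tmul rng_tmul tmul_assoc inv_tmul_self tmul_inv_self one_tmul
  tmul_one inv_tmul_tmul tmul_inv_tmul inv_tmul tmul_tmul_inv)

variable (G : TwistedGroupoid.{u})

open Classical in
/-- The cocycle as a total complex valued function, equal to `1` off the composable pairs. -/
noncomputable def tcoc (x y : G.Arr) : ℂ :=
  if h : G.src x = G.rng y then (G.cocycle x y h : ℂ) else 1

variable {G}

theorem tcoc_eq {x y : G.Arr} (h : G.src x = G.rng y) : G.tcoc x y = G.cocycle x y h :=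
  dif_pos h

theorem norm_tcoc (x y : G.Arr) : ‖G.tcoc x y‖ = 1 := by
  unfold tcoc
  split_ifs with h
  · exact Circle.norm_coe _
  · exact norm_one

theorem tcoc_mul_conj (x y : G.Arr) : G.tcoc x y * conj (G.tcoc x y) = 1 := by
  rw [Complex.mul_conj, Complex.normSq_eq_norm_sq, norm_tcoc]; simp

theorem tcoc_ne_zero (x y : G.Arr) : G.tcoc x y ≠ 0 := fun h => by
  simpa [h] using norm_tcoc x y

theorem cocycle_congr {x x' y y' : G.Arr} (hx : x = x') (hy : y = y') (h : G.src x = G.rng y) :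
    G.cocycle x y h = G.cocycle x' y' (hx ▸ hy ▸ h) := by
  subst hx hy; rfl

theorem tcoc_identity {x y z : G.Arr} (hxy : G.src x = G.rng y) (hyz : G.src y = G.rng z) :
    G.tcoc x y * G.tcoc (G.tmul x y) z = G.tcoc x (G.tmul y z) * G.tcoc y z := by
  rw [tcoc_eq hxy, tcoc_eq hyz, tcoc_eq ((src_tmul hxy).trans hyz),
    tcoc_eq (hxy.trans (rng_tmul hyz).symm), cocycle_congr (tmul_eq hxy) rfl,
    cocycle_congr rfl (tmul_eq hyz)]
  exact congrArg Circle.coeHom (G.cocycle_identity x y z hxy hyz)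

theorem tcoc_one_one (u : G.Obj) : G.tcoc (G.one u) (G.one u) = 1 := by
  rw [tcoc_eq ((G.src_one u).trans (G.rng_one u).symm), G.cocycle_one]; rfl

/-- The cocycle identity at (u, u, x) reads σ(u, x) = σ(u, x)². -/
theorem tcoc_one_left {u : G.Obj} {x : G.Arr} (h : G.rng x = u) : G.tcoc (G.one u) x = 1 := by
  have h1 : G.src (G.one u) = G.rng (G.one u) := (G.src_one u).trans (G.rng_one u).symm
  have := tcoc_identity h1 ((G.src_one u).trans h.symm)
  rw [one_tmul (G.rng_one u), one_tmul h, tcoc_one_one, one_mul] at this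
  exact mul_left_cancel₀ (tcoc_ne_zero (G.one u) x) (this.symm.trans (mul_one _).symm)

theorem tcoc_one_right {u : G.Obj} {x : G.Arr} (h : G.src x = u) : G.tcoc x (G.one u) = 1 := by
  have h1 : G.src (G.one u) = G.rng (G.one u) := (G.src_one u).trans (G.rng_one u).symm
  have := tcoc_identity (h.trans (G.rng_one u).symm) h1
  rw [one_tmul (G.rng_one u), tmul_one h, tcoc_one_one, mul_one] at this
  exact mul_left_cancel₀ (tcoc_ne_zero x (G.one u)) (this.trans (mul_one _).symm)

/-- This is the cocycle identity at (x, x⁻¹, x), where the factors involving a unit equal 1. -/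
theorem tcoc_inv_comm (x : G.Arr) : G.tcoc (G.inv x) x = G.tcoc x (G.inv x) := by
  have := tcoc_identity (G.rng_inv x).symm (G.src_inv x)
  rw [tmul_inv_self, inv_tmul_self, tcoc_one_left rfl, tcoc_one_right rfl, mul_one,
    one_mul] at this
  exact this.symm

variable (G)

theorem continuousOn_tcoc :
    ContinuousOn (fun p : G.Arr × G.Arr => G.tcoc p.1 p.2) {p | G.src p.1 = G.rng p.2} := by
  rw [continuousOn_iff_continuous_domRestrict]
  exact (continuous_subtype_val.comp G.continuous_cocycle).congr fun p => (tcoc_eq p.2).symm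

theorem continuous_Cc (f : G.Cc) : Continuous f :=
  ContinuousMap.continuous (CompactlySupportedContinuousMap.toContinuousMap f)

theorem hasCompactSupport_Cc (f : G.Cc) : HasCompactSupport f :=
  CompactlySupportedContinuousMap.hasCompactSupport' f

/-- The kernel `f(a⁻¹y) σ(a⁻¹y, y⁻¹)` of convolution by `f`. -/
noncomputable def ker (f : G.Cc) (a y : G.Arr) : ℂ :=
  f (G.tmul (G.inv a) y) * G.tcoc (G.tmul (G.inv a) y) (G.inv y)

variable {G}

theorem norm_ker (f : G.Cc) (a y : G.Arr) : ‖G.ker f a y‖ = ‖f (G.tmul (G.inv a) y)‖ := by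
  rw [ker, norm_mul, norm_tcoc, mul_one]

theorem continuousOn_ker (f : G.Cc) :
    ContinuousOn (fun p : G.Arr × G.Arr => G.ker f p.1 p.2) {p | G.rng p.1 = G.rng p.2} := by
  refine ((G.continuous_Cc f).comp_continuousOn G.continuousOn_inv_tmul).mul
    (G.continuousOn_tcoc.comp (f := fun p : G.Arr × G.Arr => (G.tmul (G.inv p.1) p.2, G.inv p.2))
      (G.continuousOn_inv_tmul.prodMk (G.continuous_inv.comp continuous_snd).continuousOn) ?_)
  intro p (hp : G.rng p.1 = G.rng p.2)
  exact (src_tmul ((G.src_inv p.1).trans hp)).trans (G.rng_inv p.2).symm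

theorem convIntegrand_eq (f : G.Cc) (g : G.Arr → ℂ) {x y : G.Arr} (h : G.src x = G.rng y) :
    G.convIntegrand f g x y = G.ker f (G.inv x) y * g (G.inv y) := by
  have h1 : G.src (G.tmul x y) = G.rng (G.inv y) := (src_tmul h).trans (G.rng_inv y).symm
  rw [convIntegrand, dif_pos h, ker, G.inv_inv, tcoc_eq h1, cocycle_congr (tmul_eq h) rfl,
    congrArg f (tmul_eq h)]
  ring

theorem mul_apply_ker (f g : G.Cc) (x : G.Arr) :
    (f * g) x = ∫ y, G.ker f (G.inv x) y * g (G.inv y) ∂(G.haar (G.src x)) := by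
  rw [Cc.mul_apply]
  refine integral_congr_ae ?_
  filter_upwards [G.ae_rng (G.src x)] with y hy using convIntegrand_eq f g hy.symm

/-- In the variable a = x⁻¹ both arguments of the kernel range over the same fibre G^{r(a)} with the
same measure; all later estimates are made in this form. -/
theorem mul_inv_apply (f g : G.Cc) (a : G.Arr) :
    (f * g) (G.inv a) = ∫ y, G.ker f a y * g (G.inv y) ∂(G.haar (G.rng a)) := by
  rw [mul_apply_ker, G.inv_inv, G.src_inv]

theorem star_apply_tcoc (f : G.Cc) (x : G.Arr) :
    (star f) x = conj (f (G.inv x) * G.tcoc x (G.inv x)) := by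
  rw [tcoc_eq (G.rng_inv x).symm]; rfl

theorem norm_star_apply (f : G.Cc) (x : G.Arr) : ‖(star f) x‖ = ‖f (G.inv x)‖ := by
  rw [star_apply_tcoc, RCLike.norm_conj, norm_mul, norm_tcoc, mul_one]

/-- The kernel of `f^*` is the adjoint kernel. -/
theorem ker_star (f : G.Cc) {a y : G.Arr} (h : G.rng a = G.rng y) :
    G.ker (star f) a y = conj (G.ker f y a) := by
  have h1 : G.src (G.inv a) = G.rng y := (G.src_inv a).trans h
  have h2 : G.src (G.inv y) = G.rng a := (G.src_inv y).trans h.symm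
  have hi : G.inv (G.tmul (G.inv a) y) = G.tmul (G.inv y) a := by rw [inv_tmul h1, G.inv_inv]
  rw [ker, star_apply_tcoc, hi, ker, map_mul, map_mul, mul_assoc]
  congr 1
  -- the cocycle identity at `(a⁻¹y, y⁻¹a, a⁻¹)`
  have h3 : G.src (G.tmul (G.inv a) y) = G.rng (G.tmul (G.inv y) a) := by
    rw [src_tmul h1, rng_tmul h2, G.rng_inv]
  have h4 : G.src (G.tmul (G.inv y) a) = G.rng (G.inv a) := by rw [src_tmul h2, G.rng_inv]
  have h5 := tcoc_identity h3 h4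
  have h6 : G.tmul (G.tmul (G.inv a) y) (G.tmul (G.inv y) a) = G.one (G.src a) := by
    rw [← hi, tmul_inv_self, rng_tmul h1, G.rng_inv]
  rw [h6, tcoc_one_left (G.rng_inv a), mul_one, tmul_tmul_inv h2] at h5
  rw [h5, map_mul]
  calc _ = (G.tcoc (G.tmul (G.inv a) y) (G.inv y) * conj (G.tcoc (G.tmul (G.inv a) y) (G.inv y))) *
      conj (G.tcoc (G.tmul (G.inv y) a) (G.inv a)) := by ring
    _ = _ := by rw [tcoc_mul_conj, one_mul]

/-- For `y` in a compact set, `f(a⁻¹y)` vanishes for `a` outside of a compact set. -/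
theorem exists_compact_tmul_inv_left {E : Type*} [Zero E] {f : G.Arr → E} (hf : HasCompactSupport f)
    {B : Set G.Arr} (hB : IsCompact B) :
    ∃ C : Set G.Arr, IsCompact C ∧ ∀ a y, G.rng a = G.rng y → y ∈ B → a ∉ C →
      f (G.tmul (G.inv a) y) = 0 := by
  obtain ⟨C, hC, h⟩ := G.exists_compact_tmul hB
    (G.isCompact_inv_preimage hf.isCompact)
  refine ⟨C, hC, fun a y hay hy ha => ?_⟩
  have h1 : G.src (G.inv a) = G.rng y := (G.src_inv a).trans hay
  have hi : G.inv (G.tmul (G.inv a) y) = G.tmul (G.inv y) a := by rw [inv_tmul h1, G.inv_inv]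
  by_contra hne
  refine ha ?_
  rw [← tmul_inv_tmul hay.symm (x := y) (y := a), ← hi]
  refine h y hy _ ?_ ?_
  · rw [mem_preimage, G.inv_inv]
    exact subset_tsupport _ hne
  · rw [G.rng_inv, src_tmul h1]

/-- For `a` in a compact set, `f(a⁻¹y)` vanishes for `y` outside of a compact set. -/
theorem exists_compact_tmul_inv_right {E : Type*} [Zero E] {f : G.Arr → E} (hf : HasCompactSupport f)
    {B : Set G.Arr} (hB : IsCompact B) :
    ∃ C : Set G.Arr, IsCompact C ∧ ∀ a y, G.rng a = G.rng y → a ∈ B → y ∉ C →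
      f (G.tmul (G.inv a) y) = 0 := by
  obtain ⟨C, hC, h⟩ := G.exists_compact_tmul hB hf.isCompact
  refine ⟨C, hC, fun a y hay ha hy => ?_⟩
  have h1 : G.src (G.inv a) = G.rng y := (G.src_inv a).trans hay
  by_contra hne
  refine hy ?_
  rw [← tmul_inv_tmul hay]
  refine h a ha _ (subset_tsupport _ hne) ?_
  rw [rng_tmul h1, G.rng_inv]

end TwistedGroupoid

/-- Cauchy–Schwarz for the weight |w|: the quadratic polynomial t ↦ ∫ |w| (|v| - t)² is nonnegative,
so its discriminant is at most zero. -/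
theorem sq_norm_integral_mul_le {α : Type*} [MeasurableSpace α] {μ : Measure α} {w v : α → ℂ}
    (hw : Integrable w μ) (hwv : Integrable (fun x => w x * v x) μ)
    (hwv2 : Integrable (fun x => ‖w x‖ * ‖v x‖ ^ 2) μ) :
    ‖∫ x, w x * v x ∂μ‖ ^ 2 ≤ (∫ x, ‖w x‖ ∂μ) * ∫ x, ‖w x‖ * ‖v x‖ ^ 2 ∂μ := by
  set I := ∫ x, ‖w x‖ * ‖v x‖ ∂μ with hI
  have h1 : Integrable (fun x => ‖w x‖ * ‖v x‖) μ := by simpa only [norm_mul] using hwv.norm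
  have h2 : ‖∫ x, w x * v x ∂μ‖ ≤ I := by
    simpa only [norm_mul] using norm_integral_le_integral_norm (μ := μ) (fun x => w x * v x)
  have h3 : I ^ 2 ≤ (∫ x, ‖w x‖ ∂μ) * ∫ x, ‖w x‖ * ‖v x‖ ^ 2 ∂μ := by
    have hd : ∀ t : ℝ, 0 ≤ (∫ x, ‖w x‖ ∂μ) * (t * t) + (-2 * I) * t
        + ∫ x, ‖w x‖ * ‖v x‖ ^ 2 ∂μ := by
      intro t
      have h0 : 0 ≤ ∫ x, ‖w x‖ * (‖v x‖ - t) ^ 2 ∂μ := integral_nonneg fun x => by positivity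
      have h4 : ∀ x, ‖w x‖ * (‖v x‖ - t) ^ 2 =
          ‖w x‖ * (t * t) + ((-2 * t) * (‖w x‖ * ‖v x‖) + ‖w x‖ * ‖v x‖ ^ 2) := fun x => by ring
      simp_rw [h4] at h0
      have h5 : Integrable (fun x => (-2 * t) * (‖w x‖ * ‖v x‖) + ‖w x‖ * ‖v x‖ ^ 2) μ :=
        (h1.const_mul _).add hwv2
      rw [integral_add (hw.norm.mul_const _) h5,
        integral_add (h1.const_mul _) hwv2, integral_mul_const, integral_const_mul] at h0
      linarith
    have := discrim_le_zero hd
    rw [discrim] at this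
    nlinarith
  exact (pow_le_pow_left₀ (norm_nonneg _) h2 2).trans h3

/-! ### Composition and adjoints of kernels -/

namespace TwistedGroupoid

open HaarGroupoid (tmul_eq src_tmul rng_tmul tmul_assoc inv_tmul_self tmul_inv_self one_tmul
  tmul_one inv_tmul_tmul tmul_inv_tmul inv_tmul tmul_tmul_inv)

variable {G : TwistedGroupoid.{u}}

theorem tmul_inv_tmul_inv_tmul {a y z : G.Arr} (hay : G.rng a = G.rng y) (hyz : G.rng y = G.rng z) :
    G.tmul (G.tmul (G.inv a) y) (G.tmul (G.inv y) z) = G.tmul (G.inv a) z := by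
  rw [tmul_assoc ((G.src_inv a).trans hay)
    ((G.rng_inv y).symm.trans (rng_tmul ((G.src_inv y).trans hyz)).symm), tmul_inv_tmul hyz]

theorem continuousOn_ker_mul (f : G.Cc) {g : G.Arr → ℂ} (hg : Continuous g) (a : G.Arr) :
    ContinuousOn (fun y => G.ker f a y * g (G.inv y)) {y | G.rng y = G.rng a} :=
  ((continuousOn_ker f).comp (f := fun y => (a, y)) (by fun_prop) fun _ hy => Eq.symm hy).mul
    (hg.comp G.continuous_inv).continuousOn

theorem inv_apply_eq_zero (g : G.Cc) {y : G.Arr} (hy : y ∉ G.inv ⁻¹' tsupport g) :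
    g (G.inv y) = 0 :=
  image_eq_zero_of_notMem_tsupport hy

theorem isCompact_inv_tsupport (g : G.Cc) : IsCompact (G.inv ⁻¹' tsupport g) :=
  G.isCompact_inv_preimage (G.hasCompactSupport_Cc g).isCompact

/-- Convolution corresponds to composition of kernels. -/
theorem ker_mul (f g : G.Cc) {a z : G.Arr} (h : G.rng a = G.rng z) :
    G.ker (f * g) a z = ∫ y, G.ker f a y * G.ker g y z ∂(G.haar (G.rng z)) := by
  have haz : G.src (G.inv a) = G.rng z := (G.src_inv a).trans h
  set w := G.tmul (G.inv a) z with hw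
  have hsw : G.src w = G.src z := src_tmul haz
  have hF : ContinuousOn (fun y => G.ker f (G.inv w) y * g (G.inv y)) {y | G.rng y = G.src z} := by
    have := continuousOn_ker_mul f (G.continuous_Cc g) (G.inv w)
    rwa [G.rng_inv, hsw] at this
  -- Translation by z moves the integral from the fibre over s(z) to the one over r(z), where a and
  -- z lie.
  have ht := G.integral_translate z hF (isCompact_inv_tsupport g)
    fun y _ hy => by rw [inv_apply_eq_zero g hy, mul_zero]
  rw [ker, ← hw, mul_apply_ker, hsw, ← ht, ← integral_mul_const]
  refine integral_congr_ae ?_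
  filter_upwards [G.ae_rng (G.rng z)] with y hy
  have hzy : G.src (G.inv z) = G.rng y := (G.src_inv z).trans hy.symm
  have hyz : G.src (G.inv y) = G.rng z := (G.src_inv y).trans hy
  have hay : G.src (G.inv a) = G.rng y := haz.trans hy.symm
  have hi : G.inv (G.tmul (G.inv z) y) = G.tmul (G.inv y) z := by rw [inv_tmul hzy, G.inv_inv]
  rw [ker, ker, ker, G.inv_inv, hi, hw, tmul_inv_tmul_inv_tmul h hy.symm]
  have h1 : G.src (G.tmul (G.inv a) y) = G.rng (G.tmul (G.inv y) z) := by
    rw [src_tmul hay, rng_tmul hyz, G.rng_inv]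
  have h2 : G.src (G.tmul (G.inv y) z) = G.rng (G.inv z) := by rw [src_tmul hyz, G.rng_inv]
  -- The phases match by the cocycle identity at (a⁻¹y, y⁻¹z, z⁻¹).
  have h3 := tcoc_identity h1 h2
  rw [tmul_inv_tmul_inv_tmul (h.trans hy.symm) hy, tmul_tmul_inv hyz] at h3
  linear_combination (f (G.tmul (G.inv a) y) * g (G.tmul (G.inv y) z)) * h3

theorem continuousOn_ker_fst (f : G.Cc) (u : G.Obj) :
    ContinuousOn (fun p : G.Arr × G.Arr => G.ker f p.1 p.2) {p | G.rng p.1 = u ∧ G.rng p.2 = u} :=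
  (continuousOn_ker f).mono fun _ hp => hp.1.trans hp.2.symm

theorem continuousOn_ker_swap (f : G.Cc) (u : G.Obj) :
    ContinuousOn (fun p : G.Arr × G.Arr => G.ker f p.2 p.1) {p | G.rng p.1 = u ∧ G.rng p.2 = u} :=
  (continuousOn_ker f).comp (f := Prod.swap) continuous_swap.continuousOn
    fun _ hp => hp.2.trans hp.1.symm

theorem continuous_comp_inv (f : G.Cc) : Continuous fun x => f (G.inv x) :=
  (G.continuous_Cc f).comp G.continuous_inv

/-- Both sides are the double integral of k_f(a, y) k_g(y, z) h(z⁻¹), by `ker_mul`, taken in the two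
orders. -/
protected theorem Cc.mul_assoc (f g h : G.Cc) : f * g * h = f * (g * h) := by
  refine Cc.ext fun x => ?_
  rw [← G.inv_inv x]
  set a := G.inv x
  set u := G.rng a with hu
  rw [mul_inv_apply, mul_inv_apply]
  -- The support of h confines z to a compact set, and then the support of g confines y to C, so
  -- that Fubini applies.
  obtain ⟨C, hC, hCz⟩ := exists_compact_tmul_inv_left (G.hasCompactSupport_Cc g)
    (isCompact_inv_tsupport h)
  have hsw := G.integral_fiber_integral_fiber_swap (u := u) (v := u)
    (F := fun z y => G.ker f a y * G.ker g y z * h (G.inv z))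
    (K := (G.inv ⁻¹' tsupport h) ×ˢ C) ?_ ((isCompact_inv_tsupport h).prod hC) ?_
  · refine Eq.trans ?_ (hsw.trans ?_)
    · refine integral_congr_ae ?_
      filter_upwards [G.ae_rng u] with z hz
      rw [ker_mul f g hz.symm, hz, ← integral_mul_const]
    · refine integral_congr_ae ?_
      filter_upwards [G.ae_rng u] with y hy
      rw [mul_inv_apply, hy, ← integral_const_mul]
      simp only [mul_assoc]
  · refine ContinuousOn.mul (ContinuousOn.mul ?_ (continuousOn_ker_swap g u))
      ((continuous_comp_inv h).comp continuous_fst).continuousOn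
    exact (continuousOn_ker f).comp (f := fun p : G.Arr × G.Arr => (a, p.2)) (by fun_prop)
      fun p hp => hp.2.symm
  · intro z y hz hy hzy
    by_cases hzs : z ∈ G.inv ⁻¹' tsupport h
    · have : G.ker g y z = 0 := by
        rw [ker, hCz y z (hy.trans hz.symm) hzs fun hyC => hzy ⟨hzs, hyC⟩, zero_mul]
      simp [this]
    · simp [inv_apply_eq_zero h hzs]

/-- On each fibre, convolution by `f^*` is the adjoint of convolution by `f`. -/
theorem integral_mul_conj (f g h : G.Cc) (u : G.Obj) :
    ∫ a, (f * g) (G.inv a) * conj (h (G.inv a)) ∂(G.haar u) =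
      ∫ a, g (G.inv a) * conj ((star f * h) (G.inv a)) ∂(G.haar u) := by
  have hsw := G.integral_fiber_integral_fiber_swap (u := u) (v := u)
    (F := fun a y => G.ker f a y * g (G.inv y) * conj (h (G.inv a)))
    (K := (G.inv ⁻¹' tsupport h) ×ˢ (G.inv ⁻¹' tsupport g)) ?_
    ((isCompact_inv_tsupport h).prod (isCompact_inv_tsupport g)) ?_
  · refine Eq.trans ?_ (hsw.trans ?_)
    · refine integral_congr_ae ?_
      filter_upwards [G.ae_rng u] with a ha
      rw [mul_inv_apply, ha, ← integral_mul_const]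
    · refine integral_congr_ae ?_
      filter_upwards [G.ae_rng u] with y hy
      rw [mul_inv_apply, hy, ← integral_conj, ← integral_const_mul]
      refine integral_congr_ae ?_
      filter_upwards [G.ae_rng u] with a ha
      rw [ker_star f (hy.trans ha.symm), map_mul, Complex.conj_conj]
      ring
  · exact ((continuousOn_ker_fst f u).mul
      ((continuous_comp_inv g).comp continuous_snd).continuousOn).mul
      (Complex.continuous_conj.comp ((continuous_comp_inv h).comp continuous_fst)).continuousOn
  · intro a y ha hy hay
    by_cases h1 : a ∈ G.inv ⁻¹' tsupport h
    · by_cases h2 : y ∈ G.inv ⁻¹' tsupport g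
      · exact absurd ⟨h1, h2⟩ hay
      · simp [inv_apply_eq_zero g h2]
    · simp [inv_apply_eq_zero h h1]

/-- `(f * f^*)(u) = ∫ |f|² dμ^u`. -/
theorem mul_star_apply_one (f : G.Cc) (u : G.Obj) :
    (f * star f) (G.one u) = ((∫ y, ‖f y‖ ^ 2 ∂(G.haar u) : ℝ) : ℂ) := by
  rw [← G.inv_one u, mul_inv_apply, G.rng_one, ← integral_complex_ofReal]
  refine integral_congr_ae ?_
  filter_upwards [G.ae_rng u] with y hy
  rw [ker, G.inv_one, one_tmul hy, star_apply_tcoc, G.inv_inv, tcoc_inv_comm, map_mul]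
  calc _ = f y * conj (f y) * (G.tcoc y (G.inv y) * conj (G.tcoc y (G.inv y))) := by ring
    _ = _ := by rw [tcoc_mul_conj, Complex.mul_conj, Complex.normSq_eq_norm_sq, mul_one]

section Translation

variable {φ : G.Arr → ℝ}

theorem integral_inv_tmul_right (hφ : Continuous φ) (hs : HasCompactSupport φ) {a : G.Arr}
    {u : G.Obj} (ha : G.rng a = u) :
    ∫ y, φ (G.tmul (G.inv a) y) ∂(G.haar u) = ∫ y, φ y ∂(G.haar (G.src a)) := by
  subst ha
  exact G.integral_translate_real a hφ.continuousOn hs.isCompact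
    fun y _ hy => image_eq_zero_of_notMem_tsupport hy

/-- Since a⁻¹y = (y⁻¹a)⁻¹, this is left translation by y applied to b ↦ φ(b⁻¹). -/
theorem integral_inv_tmul_left (hφ : Continuous φ) (hs : HasCompactSupport φ) {y : G.Arr}
    {u : G.Obj} (hy : G.rng y = u) :
    ∫ a, φ (G.tmul (G.inv a) y) ∂(G.haar u) = ∫ b, φ (G.inv b) ∂(G.haar (G.src y)) := by
  have hs' : HasCompactSupport fun b => φ (G.inv b) :=
    HasCompactSupport.intro (G.isCompact_inv_preimage hs.isCompact)
      fun b hb => image_eq_zero_of_notMem_tsupport hb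
  rw [← integral_inv_tmul_right (φ := fun b => φ (G.inv b)) (hφ.comp G.continuous_inv) hs' hy]
  refine integral_congr_ae ?_
  filter_upwards [G.ae_rng u] with a ha
  have h1 : G.src (G.inv y) = G.rng a := (G.src_inv y).trans (hy.trans ha.symm)
  change _ = φ (G.inv (G.tmul (G.inv y) a))
  rw [inv_tmul h1, G.inv_inv]

theorem continuous_integral_haar (hφ : Continuous φ) (hs : HasCompactSupport φ) :
    Continuous fun u => ∫ x, φ x ∂(G.haar u) := by
  have h := G.haar_continuous ⟨⟨fun y => (φ y : ℂ), by fun_prop⟩,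
    hs.comp_left (g := fun t : ℝ => (t : ℂ)) (by simp)⟩
  refine (Complex.continuous_re.comp h).congr fun x => ?_
  change (∫ y, (φ y : ℂ) ∂(G.haar x)).re = _
  rw [integral_complex_ofReal, Complex.ofReal_re]

/-- The integral depends continuously on u and vanishes off the compact set r(supp φ). Without this
bound the real suprema defining the I-norm could take the default value 0. -/
theorem bddAbove_integral_haar (hφ : Continuous φ) (hs : HasCompactSupport φ) :
    BddAbove (range fun u => ∫ x, φ x ∂(G.haar u)) := by
  obtain ⟨M, hM⟩ := (hs.isCompact.image G.continuous_rng).bddAbove_image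
    (continuous_integral_haar hφ hs).continuousOn
  refine ⟨max M 0, ?_⟩
  rintro _ ⟨u, rfl⟩
  by_cases hu : u ∈ G.rng '' tsupport φ
  · exact (hM ⟨u, hu, rfl⟩).trans (le_max_left _ _)
  · refine le_trans (le_of_eq ?_) (le_max_right _ _)
    refine integral_eq_zero_of_ae ?_
    filter_upwards [G.ae_rng u] with x hx
    exact image_eq_zero_of_notMem_tsupport fun h => hu ⟨x, h, hx⟩

end Translation

end TwistedGroupoid

/-! ### Schur estimates -/

namespace TwistedGroupoid

open HaarGroupoid (tmul_eq src_tmul rng_tmul tmul_assoc inv_tmul_self tmul_inv_self one_tmul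
  tmul_one inv_tmul_tmul tmul_inv_tmul inv_tmul tmul_tmul_inv)

variable {G : TwistedGroupoid.{u}}

theorem _root_.HaarGroupoid.integrable_of_continuousOn_fiber (G : HaarGroupoid.{u}) {u : G.Obj}
    {F : G.Arr → ℂ} (hF : ContinuousOn F {y | G.rng y = u}) {K : Set G.Arr} (hK : IsCompact K)
    (hz : ∀ y, G.rng y = u → y ∉ K → F y = 0) : Integrable F (G.haar u) := by
  obtain ⟨g, hg⟩ := exists_compactlySupported_eqOn (G.isClosed_fiber u) hF hK
    fun y hy hyK => hz y hy hyK
  refine (g.continuous.integrable_of_hasCompactSupport g.hasCompactSupport).congr ?_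
  filter_upwards [G.ae_rng u] with y hy using hg hy

theorem integrable_ker (f : G.Cc) {a : G.Arr} {u : G.Obj} (ha : G.rng a = u) :
    Integrable (G.ker f a) (G.haar u) := by
  obtain ⟨C, hC, hCz⟩ := exists_compact_tmul_inv_right (G.hasCompactSupport_Cc f)
    (isCompact_singleton (x := a))
  refine G.integrable_of_continuousOn_fiber ?_ hC ?_
  · exact (continuousOn_ker f).comp (f := fun y => (a, y)) (by fun_prop)
      fun _ hy => ha.trans (Eq.symm hy)
  · intro y hy hyC
    rw [ker, hCz a y (ha.trans hy.symm) rfl hyC, zero_mul]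

theorem integrable_ker_mul (f : G.Cc) {g : G.Arr → ℂ} (hg : Continuous g) {a : G.Arr} {u : G.Obj}
    (ha : G.rng a = u) : Integrable (fun y => G.ker f a y * g (G.inv y)) (G.haar u) := by
  obtain ⟨C, hC, hCz⟩ := exists_compact_tmul_inv_right (G.hasCompactSupport_Cc f)
    (isCompact_singleton (x := a))
  refine G.integrable_of_continuousOn_fiber (ha ▸ continuousOn_ker_mul f hg a) hC ?_
  intro y hy hyC
  rw [ker, hCz a y (ha.trans hy.symm) rfl hyC, zero_mul, zero_mul]

section Weights

variable {φ ψ : G.Arr → ℝ} {u : G.Obj}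

theorem continuousOn_weight (hφ : Continuous φ) (hψ : Continuous ψ) (u : G.Obj) :
    ContinuousOn (fun p : G.Arr × G.Arr => φ (G.tmul (G.inv p.1) p.2) * ψ (G.inv p.2))
      {p | G.rng p.1 = u ∧ G.rng p.2 = u} :=
  (hφ.comp_continuousOn (G.continuousOn_inv_tmul.mono fun _ hp => hp.1.trans hp.2.symm)).mul
    (hψ.comp (G.continuous_inv.comp continuous_snd)).continuousOn

theorem exists_compact_weight (hφs : HasCompactSupport φ) (hψs : HasCompactSupport ψ) (u : G.Obj) :
    ∃ K : Set (G.Arr × G.Arr), IsCompact K ∧ ∀ a y, G.rng a = u → G.rng y = u → (a, y) ∉ K →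
      φ (G.tmul (G.inv a) y) * ψ (G.inv y) = 0 := by
  have hB := G.isCompact_inv_preimage hψs.isCompact
  obtain ⟨C, hC, hCz⟩ := exists_compact_tmul_inv_left hφs hB
  refine ⟨C ×ˢ (G.inv ⁻¹' tsupport ψ), hC.prod hB, fun a y ha hy hay => ?_⟩
  by_cases hyB : y ∈ G.inv ⁻¹' tsupport ψ
  · rw [hCz a y (ha.trans hy.symm) hyB fun haC => hay ⟨haC, hyB⟩, zero_mul]
  · rw [image_eq_zero_of_notMem_tsupport hyB, mul_zero]

theorem integrable_weight (hφ : Continuous φ) (hφs : HasCompactSupport φ)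
    (hψ : Continuous ψ) (hψs : HasCompactSupport ψ) {a : G.Arr} (ha : G.rng a = u) :
    Integrable (fun y => φ (G.tmul (G.inv a) y) * ψ (G.inv y)) (G.haar u) := by
  obtain ⟨K, hK, hz⟩ := exists_compact_weight hφs hψs u
  exact G.integrable_fiber_prod_real (F := fun a y => φ (G.tmul (G.inv a) y) * ψ (G.inv y))
    (continuousOn_weight hφ hψ u) hK hz ha

theorem integrable_integral_weight (hφ : Continuous φ) (hφs : HasCompactSupport φ)
    (hψ : Continuous ψ) (hψs : HasCompactSupport ψ) (u : G.Obj) :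
    Integrable (fun a => ∫ y, φ (G.tmul (G.inv a) y) * ψ (G.inv y) ∂(G.haar u)) (G.haar u) := by
  obtain ⟨K, hK, hz⟩ := exists_compact_weight hφs hψs u
  exact G.integrable_integral_fiber_real
    (F := fun a y => φ (G.tmul (G.inv a) y) * ψ (G.inv y)) (continuousOn_weight hφ hψ u) hK hz

/-- After Fubini the inner integral over a is, by invariance, the integral of φ(b⁻¹) over the fibre
at s(y), hence at most C. This is the half of the Schur test common to the estimates below. -/
theorem integral_integral_weight_le (hφ : Continuous φ) (hφs : HasCompactSupport φ)
    (hψ : Continuous ψ) (hψs : HasCompactSupport ψ) (hφ0 : ∀ x, 0 ≤ φ x) (hψ0 : ∀ x, 0 ≤ ψ x)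
    {C : ℝ} (hC : ∀ v, ∫ b, φ (G.inv b) ∂(G.haar v) ≤ C) (u : G.Obj) :
    ∫ a, ∫ y, φ (G.tmul (G.inv a) y) * ψ (G.inv y) ∂(G.haar u) ∂(G.haar u) ≤
      C * ∫ y, ψ (G.inv y) ∂(G.haar u) := by
  obtain ⟨K, hK, hz⟩ := exists_compact_weight hφs hψs u
  rw [G.integral_fiber_integral_fiber_swap_real
    (F := fun a y => φ (G.tmul (G.inv a) y) * ψ (G.inv y)) (continuousOn_weight hφ hψ u) hK hz,
    ← integral_const_mul]
  have hint : Integrable (fun y => ψ (G.inv y)) (G.haar u) :=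
    (hψ.comp G.continuous_inv).integrable_of_hasCompactSupport
      (HasCompactSupport.intro (G.isCompact_inv_preimage hψs.isCompact)
        fun b hb => image_eq_zero_of_notMem_tsupport (f := ψ) hb)
  refine integral_mono_of_nonneg (Eventually.of_forall fun y => integral_nonneg fun a =>
    mul_nonneg (hφ0 _) (hψ0 _)) (hint.const_mul C) ?_
  filter_upwards [G.ae_rng u] with y hy
  rw [integral_mul_const, integral_inv_tmul_left hφ hφs hy]
  exact mul_le_mul_of_nonneg_right (hC _) (hψ0 _)

end Weights

theorem continuous_norm_Cc (f : G.Cc) : Continuous fun x => ‖f x‖ := (G.continuous_Cc f).norm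

theorem hasCompactSupport_norm_Cc (f : G.Cc) : HasCompactSupport fun x => ‖f x‖ :=
  (G.hasCompactSupport_Cc f).norm

theorem hasCompactSupport_norm_sq_Cc (f : G.Cc) : HasCompactSupport fun x => ‖f x‖ ^ 2 :=
  (hasCompactSupport_norm_Cc f).comp_left (g := fun t : ℝ => t ^ 2) (by simp)

theorem hasCompactSupport_comp_inv (f : G.Cc) : HasCompactSupport fun x => f (G.inv x) :=
  HasCompactSupport.intro (isCompact_inv_tsupport f) fun _ hx => inv_apply_eq_zero f hx

/-- The Schur test. -/
theorem integral_norm_sq_mul_le (f g : G.Cc) {C : ℝ}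
    (h1 : ∀ v, ∫ b, ‖f b‖ ∂(G.haar v) ≤ C) (h2 : ∀ v, ∫ b, ‖f (G.inv b)‖ ∂(G.haar v) ≤ C)
    (u : G.Obj) : ∫ a, ‖(f * g) (G.inv a)‖ ^ 2 ∂(G.haar u) ≤
      C ^ 2 * ∫ a, ‖g (G.inv a)‖ ^ 2 ∂(G.haar u) := by
  have hC : 0 ≤ C := (integral_nonneg fun _ => norm_nonneg _).trans (h1 u)
  have hf := continuous_norm_Cc f
  have hfs := hasCompactSupport_norm_Cc f
  have hg := (continuous_norm_Cc g).pow 2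
  have hgs := hasCompactSupport_norm_sq_Cc g
  have key : ∫ a, ‖(f * g) (G.inv a)‖ ^ 2 ∂(G.haar u) ≤
      ∫ a, C * ∫ y, ‖f (G.tmul (G.inv a) y)‖ * ‖g (G.inv y)‖ ^ 2 ∂(G.haar u) ∂(G.haar u) := by
    refine integral_mono_of_nonneg (Eventually.of_forall fun a => sq_nonneg _)
      ((integrable_integral_weight hf hfs hg hgs u).const_mul C) ?_
    filter_upwards [G.ae_rng u] with a ha
    rw [mul_inv_apply, ha]
    -- Cauchy–Schwarz with |k_f(a, ·)| as the weight; its total mass is at most C by left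
    -- invariance.
    refine (sq_norm_integral_mul_le (integrable_ker f ha)
      (integrable_ker_mul f (G.continuous_Cc g) ha) ?_).trans ?_
    · simp only [norm_ker]
      exact integrable_weight hf hfs hg hgs ha
    · simp only [norm_ker]
      refine mul_le_mul_of_nonneg_right ?_ (integral_nonneg fun y => by positivity)
      exact (integral_inv_tmul_right hf hfs ha).trans_le (h1 _)
  rw [integral_const_mul] at key
  refine key.trans ?_
  rw [sq C, mul_assoc]
  exact mul_le_mul_of_nonneg_left (integral_integral_weight_le hf hfs hg hgs
    (fun _ => norm_nonneg _) (fun _ => sq_nonneg _) h2 u) hC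

/-- The `L²`-norm of a convolution in terms of the `L²`-norm of the first factor. -/
theorem integral_norm_sq_mul_le' (f g : G.Cc) {D : ℝ}
    (hD : ∀ v, ∫ b, ‖f (G.inv b)‖ ^ 2 ∂(G.haar v) ≤ D) (u : G.Obj) :
    ∫ a, ‖(f * g) (G.inv a)‖ ^ 2 ∂(G.haar u) ≤ (∫ a, ‖g (G.inv a)‖ ∂(G.haar u)) ^ 2 * D := by
  set C := ∫ a, ‖g (G.inv a)‖ ∂(G.haar u) with hCdef
  have hC : 0 ≤ C := integral_nonneg fun _ => norm_nonneg _
  have hf := (continuous_norm_Cc f).pow 2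
  have hfs := hasCompactSupport_norm_sq_Cc f
  have hg := continuous_norm_Cc g
  have hgs := hasCompactSupport_norm_Cc g
  have key : ∫ a, ‖(f * g) (G.inv a)‖ ^ 2 ∂(G.haar u) ≤
      ∫ a, C * ∫ y, ‖f (G.tmul (G.inv a) y)‖ ^ 2 * ‖g (G.inv y)‖ ∂(G.haar u) ∂(G.haar u) := by
    refine integral_mono_of_nonneg (Eventually.of_forall fun a => sq_nonneg _)
      ((integrable_integral_weight hf hfs hg hgs u).const_mul C) ?_
    filter_upwards [G.ae_rng u] with a ha
    rw [mul_inv_apply, ha]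
    -- The roles are exchanged: g is now the weight, so the kernel of f is the factor that gets
    -- squared.
    have h1 : ∀ y, G.ker f a y * g (G.inv y) = g (G.inv y) * G.ker f a y := fun y => mul_comm _ _
    have h2 : ∀ y, ‖g (G.inv y)‖ * ‖G.ker f a y‖ ^ 2 =
        ‖f (G.tmul (G.inv a) y)‖ ^ 2 * ‖g (G.inv y)‖ := fun y => by rw [norm_ker, mul_comm]
    simp only [h1]
    refine (sq_norm_integral_mul_le
      ((continuous_comp_inv g).integrable_of_hasCompactSupport (hasCompactSupport_comp_inv g))
      (by simpa only [h1] using integrable_ker_mul f (G.continuous_Cc g) ha) ?_).trans ?_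
    · simp only [h2]
      exact integrable_weight hf hfs hg hgs ha
    · simp only [h2]
      exact le_rfl
  rw [integral_const_mul] at key
  refine key.trans ?_
  rw [sq C, mul_assoc, mul_comm C D]
  exact mul_le_mul_of_nonneg_left (integral_integral_weight_le hf hfs hg hgs
    (fun _ => sq_nonneg _) (fun _ => norm_nonneg _) hD u) hC

theorem integral_norm_mul_le (f g : G.Cc) {C : ℝ}
    (h2 : ∀ v, ∫ b, ‖f (G.inv b)‖ ∂(G.haar v) ≤ C) (u : G.Obj) :
    ∫ a, ‖(f * g) (G.inv a)‖ ∂(G.haar u) ≤ C * ∫ a, ‖g (G.inv a)‖ ∂(G.haar u) := by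
  have hf := continuous_norm_Cc f
  have hfs := hasCompactSupport_norm_Cc f
  have hg := continuous_norm_Cc g
  have hgs := hasCompactSupport_norm_Cc g
  refine le_trans ?_ (integral_integral_weight_le hf hfs hg hgs
    (fun _ => norm_nonneg _) (fun _ => norm_nonneg _) h2 u)
  refine integral_mono_of_nonneg (Eventually.of_forall fun a => norm_nonneg _)
      (integrable_integral_weight hf hfs hg hgs u) ?_
  filter_upwards [G.ae_rng u] with a ha
  rw [mul_inv_apply, ha]
  refine (norm_integral_le_integral_norm _).trans (le_of_eq ?_)
  simp only [norm_mul, norm_ker]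

/-! ### The `I`-norm -/

theorem continuous_norm_comp_inv (f : G.Cc) : Continuous fun x => ‖f (G.inv x)‖ :=
  (continuous_comp_inv f).norm

theorem integral_norm_le_normI (f : G.Cc) (u : G.Obj) : ∫ x, ‖f x‖ ∂(G.haar u) ≤ G.normI f :=
  (le_ciSup (bddAbove_integral_haar (continuous_norm_Cc f) (hasCompactSupport_norm_Cc f)) u).trans
    (le_max_left _ _)

theorem integral_norm_inv_le_normI (f : G.Cc) (u : G.Obj) :
    ∫ x, ‖f (G.inv x)‖ ∂(G.haar u) ≤ G.normI f :=
  (le_ciSup (bddAbove_integral_haar (continuous_norm_comp_inv f)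
    (hasCompactSupport_comp_inv f).norm) u).trans (le_max_right _ _)

theorem normI_nonneg (f : G.Cc) : 0 ≤ G.normI f :=
  le_max_of_le_left (Real.iSup_nonneg fun _ => integral_nonneg fun _ => norm_nonneg _)

theorem normI_le {f : G.Cc} {C : ℝ} (hC : 0 ≤ C) (h1 : ∀ v, ∫ b, ‖f b‖ ∂(G.haar v) ≤ C)
    (h2 : ∀ v, ∫ b, ‖f (G.inv b)‖ ∂(G.haar v) ≤ C) : G.normI f ≤ C :=
  max_le (Real.iSup_le h1 hC) (Real.iSup_le h2 hC)

theorem normI_star (f : G.Cc) : G.normI (star f) = G.normI f := by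
  simp only [normI, norm_star_apply, G.inv_inv]
  exact max_comm _ _

end TwistedGroupoid

open scoped ENNReal NNReal in
/-- Compactly supported continuous functions are dense in `L^p`, on a locally compact Hausdorff
space which need not be normal. -/
theorem MeasureTheory.MemLp.exists_hasCompactSupport_sub_le {X : Type*} [TopologicalSpace X]
    [T2Space X] [LocallyCompactSpace X] [MeasurableSpace X] [BorelSpace X] {μ : Measure X}
    [μ.Regular] {p : ℝ≥0∞} (hp : p ≠ ∞) {f : X → ℂ} (hf : MemLp f p μ) {ε : ℝ≥0∞} (hε : ε ≠ 0) :
    ∃ g : X → ℂ, eLpNorm (f - g) p μ ≤ ε ∧ Continuous g ∧ HasCompactSupport g := by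
  suffices H : ∃ g : X → ℂ, eLpNorm (f - g) p μ ≤ ε ∧ Continuous g ∧ HasCompactSupport g from H
  refine hf.induction_dense hp _ ?_ ?_ ?_ hε
  · intro c t ht htμ ε hε
    obtain ⟨δ, δpos, hδ⟩ := exists_Lp_half ℂ μ p hε
    obtain ⟨η, ηpos, hη⟩ :
        ∃ η : ℝ≥0, 0 < η ∧ ∀ s : Set X, μ s ≤ η → eLpNorm (s.indicator fun _ => c) p μ ≤ δ :=
      exists_eLpNorm_indicator_le hp c δpos.ne'
    have hη' : (0 : ℝ≥0∞) < η := ENNReal.coe_pos.2 ηpos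
    -- The set t is approximated by a compact s inside it, and s by an open V around it. Compactness
    -- of s gives a Urysohn function between s and V without normality.
    obtain ⟨s, st, hs, hsc, μs⟩ := ht.exists_isCompact_isClosed_sdiff_lt htμ.ne hη'.ne'
    obtain ⟨V, sV, hV, -, μV⟩ :=
      hsc.measurableSet.exists_isOpen_sdiff_lt ((measure_mono st).trans_lt htμ).ne hη'.ne'
    obtain ⟨χ, h1, h0, hcs, h01⟩ := exists_continuous_one_zero_of_isCompact hs hV.isClosed_compl
      (disjoint_compl_right_iff_subset.2 sV)
    have hcont : Continuous fun x => (χ x : ℂ) * c := by fun_prop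
    have hcs' : HasCompactSupport fun x => (χ x : ℂ) * c :=
      HasCompactSupport.mul_right (hcs.comp_left (g := fun t : ℝ => (t : ℂ)) (by simp))
    have I1 : eLpNorm ((s.indicator fun _ => c) - t.indicator fun _ => c) p μ ≤ δ := by
      rw [← eLpNorm_neg, neg_sub, ← indicator_sdiff st]
      exact hη _ μs.le
    have I2 : eLpNorm ((fun x => (χ x : ℂ) * c) - s.indicator fun _ => c) p μ ≤ δ := by
      refine le_trans (eLpNorm_mono (g := (V \ s).indicator fun _ => c) fun x => ?_) (hη _ μV.le)
      by_cases hxs : x ∈ s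
      · simp [hxs, h1 hxs]
      · by_cases hxV : x ∈ V
        · rw [indicator_of_mem (show x ∈ V \ s from ⟨hxV, hxs⟩), Pi.sub_apply,
            indicator_of_notMem hxs, sub_zero, norm_mul, Complex.norm_real,
            Real.norm_of_nonneg (h01 x).1]
          exact mul_le_of_le_one_left (norm_nonneg _) (h01 x).2
        · simp [hxs, hxV, h0 hxV]
    have hsm : AEStronglyMeasurable (s.indicator fun _ => c) μ :=
      aestronglyMeasurable_const.indicator hsc.measurableSet
    have I3 := (hδ _ _ (hcont.aestronglyMeasurable.sub hsm)
      (hsm.sub (aestronglyMeasurable_const.indicator ht)) I2 I1).le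
    exact ⟨_, by simpa only [sub_add_sub_cancel] using I3, hcont, hcs'⟩
  · rintro f g ⟨hf, hfs⟩ ⟨hg, hgs⟩
    exact ⟨hf.add hg, hfs.add hgs⟩
  · rintro f ⟨hf, hfs⟩
    exact hf.aestronglyMeasurable

/-! ### The representations Ind(δ_u) and their joint faithfulness -/

namespace TwistedGroupoid

open HaarGroupoid (tmul_eq src_tmul rng_tmul tmul_assoc inv_tmul_self tmul_inv_self one_tmul
  tmul_one inv_tmul_tmul tmul_inv_tmul inv_tmul tmul_tmul_inv)

variable {G : TwistedGroupoid.{u}}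

instance haarInv_regular (u : G.Obj) : (G.haarInv u).Regular :=
  Measure.Regular.map G.invHomeomorph

theorem measurableEmbedding_inv : MeasurableEmbedding G.inv :=
  G.invHomeomorph.measurableEmbedding

theorem integral_haarInv {E : Type*} [NormedAddCommGroup E] [NormedSpace ℝ E] (F : G.Arr → E)
    (u : G.Obj) : ∫ x, F x ∂(G.haarInv u) = ∫ a, F (G.inv a) ∂(G.haar u) :=
  measurableEmbedding_inv.integral_map F

theorem integral_haar_eq_haarInv {E : Type*} [NormedAddCommGroup E] [NormedSpace ℝ E]
    (F : G.Arr → E) (u : G.Obj) : ∫ y, F y ∂(G.haar u) = ∫ x, F (G.inv x) ∂(G.haarInv u) := by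
  rw [integral_haarInv]
  simp only [G.inv_inv]

theorem ae_src (u : G.Obj) : ∀ᵐ x ∂(G.haarInv u), G.src x = u := by
  rw [haarInv, measurableEmbedding_inv.ae_map_iff]
  filter_upwards [G.ae_rng u] with a ha
  rw [G.src_inv, ha]

theorem memLp_Cc (f : G.Cc) (u : G.Obj) : MemLp f 2 (G.haarInv u) :=
  (G.continuous_Cc f).memLp_of_hasCompactSupport (G.hasCompactSupport_Cc f)

/-- The class in `L²(G_u, μ_u)` of a compactly supported continuous function. -/
noncomputable def toL2 (u : G.Obj) : G.Cc →ₗ[ℂ] Lp ℂ 2 (G.haarInv u) where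
  toFun f := (memLp_Cc f u).toLp f
  map_add' _ _ := rfl
  map_smul' _ _ := rfl

theorem coeFn_toL2 (u : G.Obj) (f : G.Cc) : toL2 u f =ᵐ[G.haarInv u] f :=
  (memLp_Cc f u).coeFn_toLp

theorem inner_toL2 (u : G.Obj) (f g : G.Cc) :
    inner ℂ (toL2 u f) (toL2 u g) = ∫ a, g (G.inv a) * conj (f (G.inv a)) ∂(G.haar u) := by
  rw [L2.inner_def, ← integral_haarInv (fun x => g x * conj (f x))]
  refine integral_congr_ae ?_
  filter_upwards [coeFn_toL2 u f, coeFn_toL2 u g] with x hf hg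
  rw [hf, hg]
  rfl

theorem norm_sq_toL2 (u : G.Obj) (f : G.Cc) :
    ‖toL2 u f‖ ^ 2 = ∫ a, ‖f (G.inv a)‖ ^ 2 ∂(G.haar u) := by
  have h := inner_toL2 u f f
  rw [inner_self_eq_norm_sq_to_K] at h
  have h1 : ∀ a, f (G.inv a) * conj (f (G.inv a)) = ((‖f (G.inv a)‖ ^ 2 : ℝ) : ℂ) := fun a => by
    rw [Complex.mul_conj, Complex.normSq_eq_norm_sq]
  simp only [h1, integral_complex_ofReal] at h
  rw [← Complex.ofReal_inj, ← h]
  simp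

theorem denseRange_toL2 (u : G.Obj) : DenseRange (toL2 (G := G) u) := by
  intro ξ
  rw [Metric.mem_closure_iff]
  intro ε hε
  obtain ⟨g, hg, hgc, hgs⟩ := (Lp.memLp ξ).exists_hasCompactSupport_sub_le
    (ε := ENNReal.ofReal (ε / 2)) (by simp) (by simpa using hε)
  refine ⟨toL2 u (⟨⟨g, hgc⟩, hgs⟩ : C_c(G.Arr, ℂ)), mem_range_self _, ?_⟩
  rw [dist_eq_norm, Lp.norm_def]
  have h1 : eLpNorm (ξ - toL2 u (⟨⟨g, hgc⟩, hgs⟩ : C_c(G.Arr, ℂ)) : Lp ℂ 2 (G.haarInv u)) 2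
      (G.haarInv u) ≤ ENNReal.ofReal (ε / 2) := by
    refine le_trans (le_of_eq (eLpNorm_congr_ae ?_)) hg
    filter_upwards [Lp.coeFn_sub ξ (toL2 u (⟨⟨g, hgc⟩, hgs⟩ : C_c(G.Arr, ℂ))),
      coeFn_toL2 u (⟨⟨g, hgc⟩, hgs⟩ : C_c(G.Arr, ℂ))] with x h1 h2
    rw [h1, Pi.sub_apply, h2]
    rfl
  calc _ ≤ (ENNReal.ofReal (ε / 2)).toReal := ENNReal.toReal_mono (by simp) h1
    _ = ε / 2 := ENNReal.toReal_ofReal (by positivity)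
    _ < ε := by linarith

theorem Cc.smul_apply (c : ℂ) (f : G.Cc) (x : G.Arr) : (c • f) x = c * f x := rfl

protected theorem Cc.mul_smul (c : ℂ) (f g : G.Cc) : f * (c • g) = c • (f * g) := by
  refine Cc.ext fun x => ?_
  rw [Cc.smul_apply, mul_apply_ker, mul_apply_ker, ← integral_const_mul]
  simp only [Cc.smul_apply, mul_left_comm]

protected theorem Cc.smul_mul (c : ℂ) (f g : G.Cc) : (c • f) * g = c • (f * g) := by
  refine Cc.ext fun x => ?_
  rw [Cc.smul_apply, mul_apply_ker, mul_apply_ker, ← integral_const_mul]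
  simp only [ker, Cc.smul_apply, mul_assoc]

/-- Convolution by `f`, with values in `L²(G_u, μ_u)`. -/
noncomputable def convL2 (u : G.Obj) (f : G.Cc) : G.Cc →ₗ[ℂ] Lp ℂ 2 (G.haarInv u) where
  toFun g := toL2 u (f * g)
  map_add' g h := by rw [mul_add, map_add]
  map_smul' c g := by rw [Cc.mul_smul, map_smul, RingHom.id_apply]

theorem norm_convL2_le (u : G.Obj) (f g : G.Cc) :
    ‖convL2 u f g‖ ≤ G.normI f * ‖toL2 u g‖ := by
  have h := integral_norm_sq_mul_le f g (integral_norm_le_normI f)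
    (integral_norm_inv_le_normI f) u
  rw [← norm_sq_toL2, ← norm_sq_toL2, ← mul_pow] at h
  exact (sq_le_sq₀ (norm_nonneg _) (mul_nonneg (normI_nonneg f) (norm_nonneg _))).1 h

/-- The bounded extension of convolution by `f` to `L²(G_u, μ_u)`. -/
noncomputable def indOp (u : G.Obj) (f : G.Cc) :
    Lp ℂ 2 (G.haarInv u) →L[ℂ] Lp ℂ 2 (G.haarInv u) :=
  (convL2 u f).extendOfNorm (toL2 u)

theorem indOp_toL2 (u : G.Obj) (f g : G.Cc) : indOp u f (toL2 u g) = toL2 u (f * g) :=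
  LinearMap.extendOfNorm_eq (denseRange_toL2 u) ⟨_, norm_convL2_le u f⟩ g

theorem norm_indOp_le (u : G.Obj) (f : G.Cc) : ‖indOp u f‖ ≤ G.normI f :=
  ContinuousLinearMap.opNorm_le_bound _ (normI_nonneg f)
    (LinearMap.norm_extendOfNorm_apply_le (denseRange_toL2 u) _ (norm_convL2_le u f))

theorem ext_toL2 {u : G.Obj} {S T : Lp ℂ 2 (G.haarInv u) →L[ℂ] Lp ℂ 2 (G.haarInv u)}
    (h : ∀ g, S (toL2 u g) = T (toL2 u g)) : S = T :=
  DFunLike.coe_injective ((denseRange_toL2 u).equalizer S.continuous T.continuous (funext h))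

/-- The representation `Ind(δ_u)`. -/
noncomputable def ind (u : G.Obj) :
    G.Cc →⋆ₙₐ[ℂ] (Lp ℂ 2 (G.haarInv u) →L[ℂ] Lp ℂ 2 (G.haarInv u)) where
  toFun := indOp u
  map_zero' := ext_toL2 fun g => by simp [indOp_toL2]
  map_add' f f' := ext_toL2 fun g => by simp [indOp_toL2, add_mul]
  map_smul' c f := ext_toL2 fun g => by simp [indOp_toL2, Cc.smul_mul]
  map_mul' f f' := ext_toL2 fun g => by
    rw [mul_apply_eq_comp]
    simp only [indOp_toL2, Cc.mul_assoc]
  map_star' f := by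
    rw [ContinuousLinearMap.star_eq_adjoint, ContinuousLinearMap.eq_adjoint_iff]
    intro ξ η
    refine (denseRange_toL2 u).induction_on₂
      (p := fun ξ η => inner ℂ (indOp u (star f) ξ) η = inner ℂ ξ (indOp u f η)) ?_ ?_ ξ η
    · exact isClosed_eq (by fun_prop) (by fun_prop)
    · intro g h
      rw [indOp_toL2, indOp_toL2, inner_toL2, inner_toL2, integral_mul_conj]

theorem ind_toL2 (u : G.Obj) (f g : G.Cc) : ind u f (toL2 u g) = toL2 u (f * g) :=
  indOp_toL2 u f g

theorem norm_ind_le (u : G.Obj) (f : G.Cc) : ‖ind u f‖ ≤ G.normI f := norm_indOp_le u f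

/-- At an arrow with source `u`, the integral defining `Ind(δ_u)` is an inner product. -/
theorem exists_integral_convIntegrand_eq_inner (f : G.Cc) (x : G.Arr) :
    ∃ c : G.Cc, ∀ ξ : Lp ℂ 2 (G.haarInv (G.src x)),
      ∫ y, G.convIntegrand f ξ x y ∂(G.haar (G.src x)) = inner ℂ (toL2 (G.src x) c) ξ := by
  have := G.t2_obj
  obtain ⟨C, hC, hCz⟩ := exists_compact_tmul_inv_right (G.hasCompactSupport_Cc f)
    (isCompact_singleton (x := G.inv x))
  have hcl : IsClosed {z | G.src z = G.src x} := isClosed_eq G.continuous_src continuous_const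
  have hc : ContinuousOn (fun z => conj (G.ker f (G.inv x) (G.inv z))) {z | G.src z = G.src x} := by
    refine Complex.continuous_conj.comp_continuousOn ((continuousOn_ker f).comp
      (f := fun z => (G.inv x, G.inv z))
      (continuous_const.prodMk G.continuous_inv).continuousOn fun z hz => ?_)
    change G.rng (G.inv x) = G.rng (G.inv z)
    rw [G.rng_inv, G.rng_inv]
    exact Eq.symm hz
  -- The representing vector is the conjugate kernel z ↦ conj k_f(x⁻¹, z⁻¹), extended from the
  -- source fibre to a function in `C_c`.
  obtain ⟨c, hcz⟩ := exists_compactlySupported_eqOn hcl hc (G.isCompact_inv_preimage hC)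
    fun z (hz : G.src z = G.src x) hzC => by
      rw [ker, hCz _ (G.inv z) (by rw [G.rng_inv, G.rng_inv, hz]) rfl hzC, zero_mul, map_zero]
  refine ⟨c, fun ξ => ?_⟩
  rw [L2.inner_def, integral_haar_eq_haarInv]
  refine integral_congr_ae ?_
  filter_upwards [coeFn_toL2 (G.src x) c, ae_src (G.src x)] with z hz hs
  rw [hz, convIntegrand_eq f ξ (show G.src x = G.rng (G.inv z) by rw [G.rng_inv, hs]), G.inv_inv]
  have h1 : c z = conj (G.ker f (G.inv x) (G.inv z)) := hcz hs
  change _ = ξ z * conj (c z)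
  rw [h1, Complex.conj_conj, mul_comm]

/-- The formula is known on `C_c`. If h_n → ξ in L², a subsequence of f * h_n converges almost
everywhere to Ind(δ_u)(f) ξ. At each x with source u the integrals converge as well, being inner
products with a fixed vector. -/
theorem isInd_ind (u : G.Obj) : G.IsInd u (ind u) := by
  intro f ξ
  obtain ⟨g, hg⟩ := mem_closure_iff_seq_limit.1 ((denseRange_toL2 u) ξ)
  choose h hh using hg.1
  have h1 : Tendsto (fun n => toL2 u (h n)) atTop (𝓝 ξ) := by simpa only [hh] using hg.2
  have h2 : Tendsto (fun n => toL2 u (f * h n)) atTop (𝓝 (ind u f ξ)) := by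
    simpa only [Function.comp_def, ind_toL2] using (((ind u f).continuous.tendsto ξ).comp h1)
  obtain ⟨ns, hns, hlim⟩ := (tendstoInMeasure_of_tendsto_Lp h2).exists_seq_tendsto_ae
  have h3 : ∀ᵐ x ∂(G.haarInv u), ∀ n, toL2 u (f * h n) x = (f * h n) x :=
    ae_all_iff.2 fun n => coeFn_toL2 u (f * h n)
  filter_upwards [hlim, h3, ae_src u] with x hx hx3 hxu
  subst hxu
  refine tendsto_nhds_unique hx ?_
  obtain ⟨c, hc⟩ := exists_integral_convIntegrand_eq_inner f x
  rw [hc]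
  have h4 : ∀ n, toL2 (G.src x) (f * h n) x = inner ℂ (toL2 (G.src x) c) (toL2 (G.src x) (h n)) := by
    intro n
    rw [hx3, ← hc, Cc.mul_apply, integral_haar_eq_haarInv, integral_haar_eq_haarInv]
    refine integral_congr_ae ?_
    filter_upwards [coeFn_toL2 (G.src x) (h n), ae_src (G.src x)] with z hz hs
    have hxz : G.src x = G.rng (G.inv z) := by rw [G.rng_inv, hs]
    rw [convIntegrand_eq _ _ hxz, convIntegrand_eq _ _ hxz, G.inv_inv, hz]
  simp only [h4]
  exact ((tendsto_const_nhds.inner h1).comp hns.tendsto_atTop)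

/-- The integral formula determines the operator, so the minimal norm is a supremum with one
representation for each unit. -/
theorem IsInd.eq_ind {u : G.Obj}
    {π : G.Cc →⋆ₙₐ[ℂ] (Lp ℂ 2 (G.haarInv u) →L[ℂ] Lp ℂ 2 (G.haarInv u))} (h : G.IsInd u π)
    (f : G.Cc) : π f = ind u f :=
  ContinuousLinearMap.ext fun ξ => Lp.ext ((h f ξ).trans (isInd_ind u f ξ).symm)

theorem normMin_eq (f : G.Cc) : G.normMin f = ⨆ u : G.Obj, ‖ind u f‖ := by
  refine congrArg sSup (Set.ext fun c => ?_)
  constructor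
  · rintro ⟨u, π, hπ, rfl⟩
    exact ⟨u, by rw [hπ.eq_ind]⟩
  · rintro ⟨u, rfl⟩
    exact ⟨u, ind u, isInd_ind u, rfl⟩

theorem bddAbove_norm_ind (f : G.Cc) : BddAbove (range fun u : G.Obj => ‖ind u f‖) :=
  ⟨G.normI f, by rintro _ ⟨u, rfl⟩; exact norm_ind_le u f⟩

/-- The representations `Ind(δ_u)` are jointly faithful. -/
theorem eq_zero_of_ind_eq_zero {f : G.Cc} (h : ∀ u : G.Obj, ind u f = 0) : f = 0 := by
  refine Cc.ext fun x => ?_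
  set u := G.rng x with hu
  -- Because μ^u has full support in G^u, a continuous function vanishing almost everywhere vanishes
  -- on the fibre.
  have hsupp : ∀ {F : G.Arr → ℝ}, Continuous F → F =ᵐ[G.haar u] 0 → ∀ y, G.rng y = u → F y = 0 := by
    intro F hF h0 y hy
    by_contra hne
    have hmem : y ∈ (G.haar u).support := by rw [G.haar_support]; exact hy
    rw [Measure.mem_support_iff_forall] at hmem
    have hpos := hmem _ ((isOpen_ne_fun hF continuous_const).mem_nhds hne)
    exact hpos.ne' h0
  -- Acting on the vector f^* gives f * f^* = 0 on the fibre; its value at the unit u is ∫ |f|²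
  -- dμ^u.
  have h1 : toL2 u (f * star f) = 0 := by rw [← ind_toL2, h u, zero_apply]
  have h2 : ∫ a, ‖(f * star f) (G.inv a)‖ ^ 2 ∂(G.haar u) = 0 := by
    rw [← norm_sq_toL2, h1]; simp
  have hcs : HasCompactSupport fun a => ‖(f * star f) (G.inv a)‖ ^ 2 :=
    (hasCompactSupport_comp_inv (f * star f)).norm.comp_left (g := fun t : ℝ => t ^ 2) (by simp)
  have hc : Continuous fun a => ‖(f * star f) (G.inv a)‖ ^ 2 :=
    (continuous_norm_comp_inv (f * star f)).pow 2
  rw [integral_eq_zero_iff_of_nonneg (fun _ => sq_nonneg _)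
    (hc.integrable_of_hasCompactSupport hcs)] at h2
  have h3 := hsupp hc h2 (G.one u) (G.rng_one u)
  rw [G.inv_one, mul_star_apply_one, sq_eq_zero_iff, norm_eq_zero, Complex.ofReal_eq_zero,
    integral_eq_zero_iff_of_nonneg (fun _ => sq_nonneg _)
    (((continuous_norm_Cc f).pow 2).integrable_of_hasCompactSupport
      (hasCompactSupport_norm_sq_Cc f))] at h3
  have h4 := hsupp ((continuous_norm_Cc f).pow 2) h3 x rfl
  simpa [Cc.zero_apply] using h4

theorem Cc.ext_ind {f g : G.Cc} (h : ∀ u : G.Obj, ind u f = ind u g) : f = g :=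
  sub_eq_zero.1 (eq_zero_of_ind_eq_zero fun u => by rw [map_sub, h, sub_self])

/-- No computation with cocycles is needed: the two sides have the same image under every Ind(δ_u),
and these are jointly faithful. -/
protected theorem Cc.star_mul (f g : G.Cc) : star (f * g) = star g * star f :=
  Cc.ext_ind fun u => by rw [map_star, map_mul, map_mul, map_star, map_star, star_mul]

theorem normI_mul_le (f g : G.Cc) : G.normI (f * g) ≤ G.normI f * G.normI g := by
  have key : ∀ (f g : G.Cc) (v : G.Obj), ∫ b, ‖(f * g) (G.inv b)‖ ∂(G.haar v) ≤
      G.normI f * G.normI g := fun f g v =>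
    (integral_norm_mul_le f g (integral_norm_inv_le_normI f) v).trans
      (mul_le_mul_of_nonneg_left (integral_norm_inv_le_normI g v) (normI_nonneg f))
  refine normI_le (mul_nonneg (normI_nonneg f) (normI_nonneg g)) (fun v => ?_) (key f g)
  -- The involution exchanges the two integrals in the I-norm, so the remaining half is the first
  -- one for (f * g)^* = g^* * f^*.
  have h := key (star g) (star f) v
  rw [← Cc.star_mul, normI_star, normI_star, mul_comm] at h
  simpa only [norm_star_apply, G.inv_inv] using h

end TwistedGroupoid

/-- If b < a, then C (b/a)^(2^n) tends to 0 while staying at least 1. Multiplicative constants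
disappear on taking roots. -/
theorem le_of_forall_pow_two_pow_le {a b C : ℝ} (hb : 0 ≤ b)
    (h : ∀ n : ℕ, a ^ 2 ^ n ≤ C * b ^ 2 ^ n) : a ≤ b := by
  by_contra! hab
  have ha0 : 0 < a := hb.trans_lt hab
  have h1 : ∀ n : ℕ, 1 ≤ C * (b / a) ^ 2 ^ n := fun n => by
    rw [div_pow, ← mul_div_assoc, le_div_iff₀ (by positivity), one_mul]
    exact h n
  have h2 : Tendsto (fun n : ℕ => C * (b / a) ^ 2 ^ n) atTop (𝓝 (C * 0)) :=
    ((tendsto_pow_atTop_nhds_zero_of_lt_one (by positivity) ((div_lt_one ha0).2 hab)).comp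
      (tendsto_pow_atTop_atTop_of_one_lt (r := 2) (by norm_num))).const_mul C
  have := ge_of_tendsto' h2 h1
  linarith

/-! ### Comparison of the norms and existence of both completions -/

namespace TwistedGroupoid

variable {G : TwistedGroupoid.{u}}

/-- `I`-norm continuous `*`-homomorphisms into C*-algebras are contractive for the `I`-norm. -/
theorem norm_le_normI {A : Type*} [NonUnitalCStarAlgebra A] (π : G.Cc →⋆ₙₐ[ℂ] A) {C : ℝ}
    (hC : ∀ g, ‖π g‖ ≤ C * G.normI g) (f : G.Cc) : ‖π f‖ ≤ G.normI f := by
  have hsa : ∀ g : G.Cc, IsSelfAdjoint (π g) → ‖π g‖ ≤ G.normI g := by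
    intro g hg
    -- Repeated squaring, s n = g^(2^n): the C*-identity makes the norm of the image exactly
    -- multiplicative along s, while the I-norm is submultiplicative, so the constant C is lost in
    -- the limit.
    let s : ℕ → G.Cc := fun n => Nat.rec g (fun _ k => k * k) n
    have hs : ∀ n, s (n + 1) = s n * s n := fun n => rfl
    have h1 : ∀ n, IsSelfAdjoint (π (s n)) ∧ ‖π (s n)‖ = ‖π g‖ ^ 2 ^ n := by
      intro n
      induction n with
      | zero => exact ⟨hg, by rw [pow_zero, pow_one]; rfl⟩
      | succ n ih =>
        rw [hs, map_mul]
        refine ⟨?_, ?_⟩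
        · rw [IsSelfAdjoint, star_mul, ih.1.star_eq]
        · nth_rw 1 [← ih.1.star_eq]
          rw [CStarRing.norm_star_mul_self, ih.2, pow_succ, pow_mul, sq]
    have h2 : ∀ n, G.normI (s n) ≤ G.normI g ^ 2 ^ n := by
      intro n
      induction n with
      | zero => rw [pow_zero, pow_one]; exact le_rfl
      | succ n ih =>
        rw [hs, pow_succ, pow_mul, sq]
        exact (normI_mul_le _ _).trans (mul_le_mul ih ih (normI_nonneg _)
          (pow_nonneg (normI_nonneg g) _))
    refine le_of_forall_pow_two_pow_le (C := |C|) (normI_nonneg g) fun n => ?_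
    rw [← (h1 n).2]
    calc _ ≤ C * G.normI (s n) := hC _
      _ ≤ |C| * G.normI (s n) := mul_le_mul_of_nonneg_right (le_abs_self C) (normI_nonneg _)
      _ ≤ _ := mul_le_mul_of_nonneg_left (h2 n) (abs_nonneg C)
  have h := hsa (star f * f) (by rw [map_mul, map_star]; exact IsSelfAdjoint.star_mul_self _)
  rw [map_mul, map_star, CStarRing.norm_star_mul_self] at h
  have h2 := h.trans (normI_mul_le (star f) f)
  rw [normI_star, ← sq, ← sq] at h2
  exact (sq_le_sq₀ (norm_nonneg _) (normI_nonneg f)).1 h2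

theorem norm_ind_le_normMin (u : G.Obj) (f : G.Cc) : ‖ind u f‖ ≤ G.normMin f := by
  rw [normMin_eq]
  exact le_ciSup (bddAbove_norm_ind f) u

theorem normMin_nonneg (f : G.Cc) : 0 ≤ G.normMin f := by
  rw [normMin_eq]
  exact Real.iSup_nonneg fun _ => norm_nonneg _

theorem normMin_le {f : G.Cc} {C : ℝ} (hC : 0 ≤ C) (h : ∀ u, ‖ind u f‖ ≤ C) : G.normMin f ≤ C := by
  rw [normMin_eq]
  exact Real.iSup_le h hC

/-- Automatic contractivity bounds the set defining the maximal norm by the I-norm, so its supremum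
is genuine. -/
theorem norm_le_normMax {E : Type u} [NormedAddCommGroup E] [InnerProductSpace ℂ E]
    [CompleteSpace E] (π : G.Cc →⋆ₙₐ[ℂ] (E →L[ℂ] E)) (hπ : ∃ C : ℝ, ∀ g, ‖π g‖ ≤ C * G.normI g)
    (f : G.Cc) : ‖π f‖ ≤ G.normMax f := by
  refine le_csSup ⟨G.normI f, ?_⟩ ⟨E, inferInstance, inferInstance, inferInstance, π, hπ, rfl⟩
  rintro _ ⟨E, _, _, _, π, ⟨C, hC⟩, rfl⟩
  exact norm_le_normI π hC f

theorem normMax_nonneg (f : G.Cc) : 0 ≤ G.normMax f :=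
  Real.sSup_nonneg (by rintro _ ⟨E, _, _, _, π, -, rfl⟩; exact norm_nonneg _)

theorem normMax_le {f : G.Cc} {C : ℝ} (hC : 0 ≤ C)
    (h : ∀ (E : Type u) [NormedAddCommGroup E] [InnerProductSpace ℂ E] [CompleteSpace E]
      (π : G.Cc →⋆ₙₐ[ℂ] (E →L[ℂ] E)), (∃ C : ℝ, ∀ g, ‖π g‖ ≤ C * G.normI g) → ‖π f‖ ≤ C) :
    G.normMax f ≤ C :=
  Real.sSup_le (by rintro _ ⟨E, _, _, _, π, hπ, rfl⟩; exact h E π hπ) hC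

theorem norm_ind_le_normMax (u : G.Obj) (f : G.Cc) : ‖ind u f‖ ≤ G.normMax f :=
  norm_le_normMax (ind u) ⟨1, fun g => by rw [one_mul]; exact norm_ind_le u g⟩ f

theorem normMin_le_normMax (f : G.Cc) : G.normMin f ≤ G.normMax f :=
  normMin_le (normMax_nonneg f) fun u => norm_ind_le_normMax u f

theorem normMax_le_normI (f : G.Cc) : G.normMax f ≤ G.normI f :=
  normMax_le (normI_nonneg f) fun _ _ _ _ π ⟨_, hC⟩ => norm_le_normI π hC f

variable (G)

theorem exists_isCompletion_normMin :
    ∃ (A : CStarCat.{u}) (ι : G.Cc →⋆ₙₐ[ℂ] A), G.IsCompletion G.normMin ι :=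
  exists_isCompletion (fun u : ULift.{u} G.Obj =>
      Lp ℂ 2 (G.haarInv u.down) →L[ℂ] Lp ℂ 2 (G.haarInv u.down)) (fun u => ind u.down)
    (fun f => by rw [normMin_eq]; exact (Equiv.ulift.iSup_comp (g := fun u => ‖ind u f‖)).symm)
    (fun f => ⟨G.normI f, by rintro _ ⟨u, rfl⟩; exact norm_ind_le _ f⟩)
    fun _ h => eq_zero_of_ind_eq_zero fun u => h ⟨u⟩

/-- All representations together do not form a family indexed in the given universe. For each f and
n one representation within 1/(n+1) of the supremum at f is chosen; this family, indexed by pairs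
(f, n), has the same suprema. It is faithful because the maximal norm dominates every Ind(δ_u). -/
theorem exists_isCompletion_normMax :
    ∃ (A : CStarCat.{u}) (ι : G.Cc →⋆ₙₐ[ℂ] A), G.IsCompletion G.normMax ι := by
  have hex : ∀ p : G.Cc × ℕ, ∃ (E : Type u) (_ : NormedAddCommGroup E) (_ : InnerProductSpace ℂ E)
      (_ : CompleteSpace E) (π : G.Cc →⋆ₙₐ[ℂ] (E →L[ℂ] E)),
      (∃ C : ℝ, ∀ g, ‖π g‖ ≤ C * G.normI g) ∧ G.normMax p.1 - 1 / (p.2 + 1) < ‖π p.1‖ := by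
    rintro ⟨f, n⟩
    obtain ⟨c, ⟨E, i1, i2, i3, π, hπ, rfl⟩, hlt⟩ := exists_lt_of_lt_csSup
      (s := {c : ℝ | ∃ (E : Type u) (_ : NormedAddCommGroup E) (_ : InnerProductSpace ℂ E)
        (_ : CompleteSpace E) (π : G.Cc →⋆ₙₐ[ℂ] (E →L[ℂ] E)),
        (∃ C : ℝ, ∀ g, ‖π g‖ ≤ C * G.normI g) ∧ c = ‖π f‖})
      -- The zero representation on the zero space shows that the set is nonempty.
      ⟨_, EuclideanSpace ℂ PEmpty.{u + 1}, inferInstance, inferInstance, inferInstance,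
        { toFun := fun _ => 0, map_smul' := fun _ _ => (smul_zero _).symm, map_zero' := rfl,
          map_add' := fun _ _ => (add_zero _).symm, map_mul' := fun _ _ => (mul_zero _).symm,
          map_star' := fun _ => (star_zero _).symm },
        ⟨0, fun g => norm_zero.trans_le (zero_mul (G.normI g)).ge⟩, rfl⟩
      (show G.normMax f - 1 / ((n : ℝ) + 1) < G.normMax f from sub_lt_self _ (by positivity))
    exact ⟨E, i1, i2, i3, π, hπ, hlt⟩
  choose E i1 i2 i3 π hπ hlt using hex
  have hle : ∀ p f, ‖π p f‖ ≤ G.normMax f := fun p f => norm_le_normMax (π p) (hπ p) f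
  have hN : ∀ f, G.normMax f = ⨆ p, ‖π p f‖ := by
    intro f
    have hbdd : BddAbove (range fun p => ‖π p f‖) :=
      ⟨G.normMax f, by rintro _ ⟨p, rfl⟩; exact hle p f⟩
    refine le_antisymm ?_ (Real.iSup_le (fun p => hle p f) (normMax_nonneg f))
    refine le_of_forall_pos_le_add fun ε hε => ?_
    obtain ⟨n, hn⟩ := exists_nat_one_div_lt hε
    have h1 := hlt (f, n)
    have h2 := le_ciSup hbdd (f, n)
    simp only at h1 h2
    linarith
  refine exists_isCompletion (fun p => E p →L[ℂ] E p) π hN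
    (fun f => ⟨G.normMax f, by rintro _ ⟨p, rfl⟩; exact hle p f⟩) fun f hf => ?_
  refine eq_zero_of_ind_eq_zero fun u => norm_le_zero_iff.1 ((norm_ind_le_normMax u f).trans ?_)
  rw [hN]
  exact Real.iSup_le (fun p => by rw [hf p, norm_zero]) le_rfl

end TwistedGroupoid

/-! ### The induced `*`-homomorphism and its norm estimates -/

namespace PartialMorphism

variable {G H : TwistedGroupoid.{u}}

theorem one_rng_mem (φ : PartialMorphism G H) {x : G.Arr} (hx : x ∈ φ.toPFun.Dom) :
    G.one (G.rng x) ∈ φ.toPFun.Dom := by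
  rw [← G.mul_inv x]
  exact φ.mul_mem x hx _ (φ.inv_mem x hx) _

theorem one_src_mem (φ : PartialMorphism G H) {x : G.Arr} (hx : x ∈ φ.toPFun.Dom) :
    G.one (G.src x) ∈ φ.toPFun.Dom := by
  rw [← G.inv_mul x]
  exact φ.mul_mem _ (φ.inv_mem x hx) x hx _

theorem src_fn (φ : PartialMorphism G H) {x : G.Arr} (hx : x ∈ φ.toPFun.Dom) :
    H.src (φ.toPFun.fn x hx) = H.rng (φ.toPFun.fn (G.one (G.src x)) (φ.one_src_mem hx)) :=
  φ.composable x hx _ _ (G.rng_one _).symm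

theorem mem_of_inv_mem (φ : PartialMorphism G H) {x : G.Arr} (hx : G.inv x ∈ φ.toPFun.Dom) :
    x ∈ φ.toPFun.Dom := by
  rw [← G.inv_inv x]
  exact φ.inv_mem _ hx

open Classical in
/-- The pullback of a function along a partial morphism, extended by zero. -/
noncomputable def pull {E : Type*} [Zero E] (φ : PartialMorphism G H) (F : H.Arr → E) (x : G.Arr) :
    E :=
  if hx : x ∈ φ.toPFun.Dom then F (φ.toPFun.fn x hx) else 0

section Pull

variable {E : Type*} [Zero E] (φ : PartialMorphism G H)

theorem pull_of_mem (F : H.Arr → E) {x : G.Arr} (hx : x ∈ φ.toPFun.Dom) :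
    φ.pull F x = F (φ.toPFun.fn x hx) := dif_pos hx

theorem pull_of_notMem (F : H.Arr → E) {x : G.Arr} (hx : x ∉ φ.toPFun.Dom) :
    φ.pull F x = 0 := dif_neg hx

end Pull

/-- The Haar measure of the range of `φ(u)` is the image of the restriction of `μ^u`. -/
theorem integral_pull {E : Type*} [NormedAddCommGroup E] [NormedSpace ℝ E]
    (φ : PartialMorphism G H) {u : G.Obj} (hu : G.one u ∈ φ.toPFun.Dom) {F : H.Arr → E}
    (hF : AEStronglyMeasurable F (H.haar (H.rng (φ.toPFun.fn (G.one u) hu)))) :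
    ∫ x, φ.pull F x ∂(G.haar u) = ∫ y, F y ∂(H.haar (H.rng (φ.toPFun.fn (G.one u) hu))) := by
  have hK : MeasurableSet φ.toPFun.Dom := φ.isOpen_dom.measurableSet
  have hm : Measurable φ.toPFun.asSubtype := φ.isProperMap.continuous.measurable
  have hmap : ((G.haar u).comap Subtype.val).map φ.toPFun.asSubtype =
      H.haar (H.rng (φ.toPFun.fn (G.one u) hu)) := by
    refine Measure.ext fun B hB => ?_
    rw [Measure.map_apply hm hB, (MeasurableEmbedding.subtype_coe hK).comap_apply,
      PFun.image_val_preimage_asSubtype, φ.map_haar u hu B hB]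
  rw [← hmap] at hF ⊢
  rw [integral_map hm.aemeasurable hF, ← setIntegral_eq_integral_of_forall_compl_eq_zero
    (s := φ.toPFun.Dom) fun x hx => φ.pull_of_notMem F hx, ← integral_subtype_comap hK]
  exact integral_congr_ae (Eventually.of_forall fun x => φ.pull_of_mem F x.2)

/-- An arrow of K with range u would force the unit at u into K, so K misses the fibre G^u. -/
theorem integral_pull_of_notMem {E : Type*} [NormedAddCommGroup E] [NormedSpace ℝ E]
    (φ : PartialMorphism G H) {u : G.Obj} (hu : G.one u ∉ φ.toPFun.Dom) (F : H.Arr → E) :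
    ∫ x, φ.pull F x ∂(G.haar u) = 0 := by
  refine integral_eq_zero_of_ae ?_
  filter_upwards [G.ae_rng u] with x hx
  exact φ.pull_of_notMem F fun h => hu (hx ▸ φ.one_rng_mem h)

theorem integral_pull_le (φ : PartialMorphism G H) {F : H.Arr → ℝ} (hF : Continuous F)
    (hFs : HasCompactSupport F) {C : ℝ} (hC0 : 0 ≤ C) (hC : ∀ v, ∫ y, F y ∂(H.haar v) ≤ C)
    (u : G.Obj) : ∫ x, φ.pull F x ∂(G.haar u) ≤ C := by
  by_cases hu : G.one u ∈ φ.toPFun.Dom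
  · rw [φ.integral_pull hu
      (hF.integrable_of_hasCompactSupport hFs).aestronglyMeasurable]
    exact hC _
  · rw [φ.integral_pull_of_notMem hu]
    exact hC0

/-- For x in K, the image condition on Haar measures carries the fibre integral to H and the
integrands agree on K; for y outside K the factor at y⁻¹ is zero. For x outside K, the arrows xy and
y⁻¹ cannot both lie in K, as their product is x. -/
theorem induced_mul (φ : PartialMorphism G H) (f g : H.Cc) :
    φ.induced (f * g) = φ.induced f * φ.induced g := by
  refine TwistedGroupoid.Cc.ext fun x => ?_
  rw [TwistedGroupoid.Cc.mul_apply]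
  by_cases hx : x ∈ φ.toPFun.Dom
  · have hmeas : AEStronglyMeasurable (H.convIntegrand f g (φ.toPFun.fn x hx))
        (H.haar (H.rng (φ.toPFun.fn (G.one (G.src x)) (φ.one_src_mem hx)))) := by
      rw [← φ.src_fn hx]
      exact (H.integrable_convIntegrand f g (φ.toPFun.fn x hx)).aestronglyMeasurable
    rw [induced_of_mem φ _ hx, TwistedGroupoid.Cc.mul_apply, φ.src_fn hx, ← φ.integral_pull _ hmeas]
    refine integral_congr_ae ?_
    filter_upwards [G.ae_rng (G.src x)] with y hy
    by_cases hyd : y ∈ φ.toPFun.Dom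
    · have hc := φ.composable x hx y hyd hy.symm
      have hm := φ.mul_mem x hx y hyd hy.symm
      rw [φ.pull_of_mem _ hyd, TwistedGroupoid.convIntegrand, TwistedGroupoid.convIntegrand,
        dif_pos hc, dif_pos hy.symm, induced_of_mem φ f hm,
        induced_of_mem φ g (φ.inv_mem y hyd), φ.fn_inv hyd,
        φ.map_cocycle _ hm _ (φ.inv_mem y hyd),
        TwistedGroupoid.cocycle_congr (φ.map_mul x hx y hyd hy.symm) (φ.fn_inv hyd),
        congrArg f (φ.map_mul x hx y hyd hy.symm)]
    · rw [φ.pull_of_notMem _ hyd, TwistedGroupoid.convIntegrand, dif_pos hy.symm,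
        induced_of_notMem φ g fun h => hyd (φ.mem_of_inv_mem h), mul_zero, zero_mul]
  · rw [induced_of_notMem φ _ hx]
    refine (integral_eq_zero_of_ae ?_).symm
    filter_upwards [G.ae_rng (G.src x)] with y hy
    rw [TwistedGroupoid.convIntegrand, dif_pos hy.symm, Pi.zero_apply]
    by_cases hi : G.inv y ∈ φ.toPFun.Dom
    · rw [induced_of_notMem φ f, zero_mul, zero_mul]
      intro hm
      have := φ.mul_mem _ hm _ hi ((G.src_mul x y hy.symm).trans (G.rng_inv y).symm)
      rw [G.mul_mul_inv] at this
      exact hx this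
    · rw [induced_of_notMem φ g hi, mul_zero, zero_mul]

theorem induced_star (φ : PartialMorphism G H) (f : H.Cc) :
    φ.induced (star f) = star (φ.induced f) := by
  refine TwistedGroupoid.Cc.ext fun x => ?_
  change _ = conj (φ.induced f (G.inv x) * (G.cocycle x (G.inv x) (G.rng_inv x).symm : ℂ))
  by_cases hx : x ∈ φ.toPFun.Dom
  · rw [induced_of_mem φ _ hx, induced_of_mem φ f (φ.inv_mem x hx), φ.fn_inv hx,
      φ.map_cocycle x hx _ (φ.inv_mem x hx),
      TwistedGroupoid.cocycle_congr rfl (φ.fn_inv hx)]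
    rfl
  · rw [induced_of_notMem φ _ hx, induced_of_notMem φ f fun h => hx (φ.mem_of_inv_mem h), zero_mul,
      map_zero]

/-- The induced map as a `*`-homomorphism. -/
noncomputable def inducedHom (φ : PartialMorphism G H) : H.Cc →⋆ₙₐ[ℂ] G.Cc where
  toFun := φ.induced
  map_zero' := TwistedGroupoid.Cc.ext fun x => by
    by_cases hx : x ∈ φ.toPFun.Dom
    · exact induced_of_mem φ _ hx
    · exact induced_of_notMem φ _ hx
  map_add' f g := TwistedGroupoid.Cc.ext fun x => by
    rw [TwistedGroupoid.Cc.add_apply]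
    by_cases hx : x ∈ φ.toPFun.Dom
    · rw [induced_of_mem φ _ hx, induced_of_mem φ _ hx, induced_of_mem φ _ hx,
        TwistedGroupoid.Cc.add_apply]
    · rw [induced_of_notMem φ _ hx, induced_of_notMem φ _ hx, induced_of_notMem φ _ hx, add_zero]
  map_smul' c f := TwistedGroupoid.Cc.ext fun x => by
    rw [MonoidHom.id_apply, TwistedGroupoid.Cc.smul_apply]
    by_cases hx : x ∈ φ.toPFun.Dom
    · rw [induced_of_mem φ _ hx, induced_of_mem φ _ hx, TwistedGroupoid.Cc.smul_apply]
    · rw [induced_of_notMem φ _ hx, induced_of_notMem φ _ hx, mul_zero]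
  map_mul' := φ.induced_mul
  map_star' := φ.induced_star

theorem norm_induced (φ : PartialMorphism G H) (f : H.Cc) (x : G.Arr) :
    ‖φ.induced f x‖ = φ.pull (fun y => ‖f y‖) x := by
  by_cases hx : x ∈ φ.toPFun.Dom
  · rw [induced_of_mem φ _ hx, φ.pull_of_mem _ hx]
  · rw [induced_of_notMem φ _ hx, φ.pull_of_notMem _ hx, norm_zero]

theorem norm_induced_inv (φ : PartialMorphism G H) (f : H.Cc) (x : G.Arr) :
    ‖φ.induced f (G.inv x)‖ = φ.pull (fun y => ‖f (H.inv y)‖) x := by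
  by_cases hx : x ∈ φ.toPFun.Dom
  · rw [induced_of_mem φ _ (φ.inv_mem x hx), φ.pull_of_mem _ hx, φ.fn_inv]
  · rw [induced_of_notMem φ _ fun h => hx (φ.mem_of_inv_mem h), φ.pull_of_notMem _ hx, norm_zero]

theorem norm_sq_induced_inv (φ : PartialMorphism G H) (f : H.Cc) (x : G.Arr) :
    ‖φ.induced f (G.inv x)‖ ^ 2 = φ.pull (fun y => ‖f (H.inv y)‖ ^ 2) x := by
  rw [norm_induced_inv]
  by_cases hx : x ∈ φ.toPFun.Dom
  · rw [φ.pull_of_mem _ hx, φ.pull_of_mem _ hx]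
  · rw [φ.pull_of_notMem _ hx, φ.pull_of_notMem _ hx, sq, mul_zero]

open TwistedGroupoid

theorem normI_induced_le (φ : PartialMorphism G H) (f : H.Cc) :
    G.normI (φ.induced f) ≤ H.normI f := by
  refine normI_le (normI_nonneg f) (fun v => ?_) fun v => ?_
  · simp only [norm_induced]
    exact φ.integral_pull_le (continuous_norm_Cc f) (hasCompactSupport_norm_Cc f) (normI_nonneg f)
      (integral_norm_le_normI f) v
  · simp only [norm_induced_inv]
    exact φ.integral_pull_le (continuous_norm_comp_inv f) (hasCompactSupport_comp_inv f).norm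
      (normI_nonneg f) (integral_norm_inv_le_normI f) v

/-- Composing an I-continuous representation with φ^* gives another one, because φ^* does not
increase the I-norm. -/
theorem normMax_induced_le (φ : PartialMorphism G H) (f : H.Cc) :
    G.normMax (φ.induced f) ≤ H.normMax f := by
  refine normMax_le (normMax_nonneg f) fun E _ _ _ π hπ => ?_
  obtain ⟨C, hC⟩ := hπ
  refine norm_le_normMax (π.comp φ.inducedHom) ⟨|C|, fun g => ?_⟩ f
  calc ‖π (φ.induced g)‖ ≤ C * G.normI (φ.induced g) := hC _
    _ ≤ |C| * G.normI (φ.induced g) :=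
      mul_le_mul_of_nonneg_right (le_abs_self C) (normI_nonneg _)
    _ ≤ |C| * H.normI g := mul_le_mul_of_nonneg_left (φ.normI_induced_le g) (abs_nonneg C)

/-- A self-adjoint operator is bounded by `M` as soon as its powers grow at most like `M ^ n` on a
dense set of vectors. -/
theorem _root_.IsSelfAdjoint.norm_le_of_pow_le {E : Type*} [NormedAddCommGroup E]
    [InnerProductSpace ℂ E] [CompleteSpace E] {T : E →L[ℂ] E} (hT : IsSelfAdjoint T) {M : ℝ}
    (hM : 0 ≤ M) {S : Set E} (hS : Dense S)
    (h : ∀ ξ ∈ S, ∃ C, ∀ n : ℕ, ‖(T ^ (n + 1)) ξ‖ ≤ C * M ^ n) : ‖T‖ ≤ M := by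
  refine T.opNorm_le_bound hM fun ξ => ?_
  refine hS.induction (P := fun ξ => ‖T ξ‖ ≤ M * ‖ξ‖) ?_
    (isClosed_le (by fun_prop) (by fun_prop)) ξ
  intro ξ hξ
  obtain ⟨C, hC⟩ := h ξ hξ
  rcases eq_or_ne ξ 0 with rfl | h0
  · simp
  have hξ0 : 0 < ‖ξ‖ := norm_pos_iff.2 h0
  -- Cauchy–Schwarz applied to ⟨T^{2n} ξ, ξ⟩ = ‖T^n ξ‖².
  have hsq : ∀ n : ℕ, ‖(T ^ n) ξ‖ ^ 2 ≤ ‖(T ^ (n * 2)) ξ‖ * ‖ξ‖ := by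
    intro n
    have hsa : IsSelfAdjoint (T ^ n) := hT.pow n
    have h1 : inner ℂ ((T ^ n) ((T ^ n) ξ)) ξ = inner ℂ ((T ^ n) ξ) ((T ^ n) ξ) :=
      hsa.isSymmetric _ _
    have h2 : (T ^ n) ((T ^ n) ξ) = (T ^ (n * 2)) ξ := by
      rw [mul_two, pow_add, mul_apply_eq_comp]
    rw [h2] at h1
    have h3 := norm_inner_le_norm (𝕜 := ℂ) ((T ^ (n * 2)) ξ) ξ
    rwa [h1, inner_self_eq_norm_sq_to_K, norm_pow, RCLike.norm_ofReal, abs_norm] at h3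
  have hb : ∀ n : ℕ, (‖T ξ‖ / ‖ξ‖) ^ 2 ^ n ≤ ‖(T ^ (2 ^ n)) ξ‖ / ‖ξ‖ := by
    intro n
    induction n with
    | zero => simp
    | succ n ih =>
      rw [pow_succ 2 n, pow_mul]
      refine (pow_le_pow_left₀ (by positivity) ih 2).trans ?_
      rw [div_pow, div_le_div_iff₀ (by positivity) hξ0]
      have := mul_le_mul_of_nonneg_right (hsq (2 ^ n)) hξ0.le
      calc _ ≤ _ := this
        _ = _ := by ring
  -- The hypothesis bounds T^(n+1) by M^n, so matching exponents costs a division; M + ε keeps this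
  -- legitimate when M = 0.
  have hle : ∀ ε > 0, ‖T ξ‖ / ‖ξ‖ ≤ M + ε := by
    intro ε hε
    have hMε : 0 < M + ε := by linarith
    refine le_of_forall_pow_two_pow_le (C := |C| / ‖ξ‖ / (M + ε)) hMε.le fun n => ?_
    obtain ⟨m, hm⟩ : ∃ m, 2 ^ n = m + 1 := ⟨2 ^ n - 1, (Nat.sub_add_cancel Nat.one_le_two_pow).symm⟩
    refine (hb n).trans ?_
    rw [hm]
    have h1 : ‖(T ^ (m + 1)) ξ‖ ≤ |C| * (M + ε) ^ m :=
      (hC m).trans (mul_le_mul (le_abs_self C) (pow_le_pow_left₀ hM (by linarith) m)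
        (pow_nonneg hM m) (abs_nonneg C))
    calc ‖(T ^ (m + 1)) ξ‖ / ‖ξ‖ ≤ |C| * (M + ε) ^ m / ‖ξ‖ := by gcongr
      _ = _ := by rw [pow_succ]; field_simp
  rw [← div_le_iff₀ hξ0]
  exact le_of_forall_pos_le_add hle

end PartialMorphism

/-! ### Contractivity of the induced map for the minimal norm -/

namespace TwistedGroupoid

variable {G H : TwistedGroupoid.{u}}

/-- The convolution powers of `F`. -/
noncomputable def convPow (F : G.Cc) : ℕ → G.Cc
  -- The algebra need not have a unit, so index n stands for the power n + 1.
  | 0 => F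
  | n + 1 => F * convPow F n

theorem norm_toL2_convPow_le (F : G.Cc) {M : ℝ} (hM0 : 0 ≤ M) {v : G.Obj} (hM : ‖ind v F‖ ≤ M)
    (n : ℕ) : ‖toL2 v (convPow F n)‖ ≤ M ^ n * ‖toL2 v F‖ := by
  induction n with
  | zero => rw [pow_zero, one_mul, convPow]
  | succ n ih =>
    rw [convPow, ← ind_toL2, pow_succ', mul_assoc]
    exact (ContinuousLinearMap.le_opNorm _ _).trans (mul_le_mul hM ih (norm_nonneg _) hM0)

theorem ind_induced_pow_toL2 (φ : PartialMorphism G H) (u : G.Obj) (F : H.Cc) (n : ℕ) (g : G.Cc) :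
    (ind u (φ.induced F) ^ (n + 1)) (toL2 u g) = toL2 u (φ.induced (convPow F n) * g) := by
  induction n with
  | zero => rw [zero_add, pow_one, ind_toL2, convPow]
  | succ n ih =>
    rw [pow_succ', mul_apply_eq_comp, ih, ind_toL2, ← Cc.mul_assoc, ← φ.induced_mul, convPow]

theorem continuous_norm_sq_comp_inv (f : G.Cc) : Continuous fun x => ‖f (G.inv x)‖ ^ 2 :=
  (continuous_norm_comp_inv f).pow 2

theorem hasCompactSupport_norm_sq_comp_inv (f : G.Cc) :
    HasCompactSupport fun x => ‖f (G.inv x)‖ ^ 2 :=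
  (hasCompactSupport_comp_inv f).norm.comp_left (g := fun t : ℝ => t ^ 2) (by simp)

/-- The fibrewise L¹-norm of g is paired with L²-norms of the pullback. On each fibre the latter is
zero or an L²-norm of h on a fibre of H, so a uniform bound over H passes to G. -/
theorem norm_toL2_induced_mul_le (φ : PartialMorphism G H) (h : H.Cc) (g : G.Cc) {D : ℝ}
    (hD0 : 0 ≤ D) (hD : ∀ v, ‖toL2 v h‖ ≤ D) (u : G.Obj) :
    ‖toL2 u (φ.induced h * g)‖ ≤ (∫ a, ‖g (G.inv a)‖ ∂(G.haar u)) * D := by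
  have hc : 0 ≤ ∫ a, ‖g (G.inv a)‖ ∂(G.haar u) := integral_nonneg fun _ => norm_nonneg _
  refine (sq_le_sq₀ (norm_nonneg _) (mul_nonneg hc hD0)).1 ?_
  rw [norm_sq_toL2, mul_pow]
  refine integral_norm_sq_mul_le' (φ.induced h) g (fun v => ?_) u
  simp only [φ.norm_sq_induced_inv]
  refine φ.integral_pull_le (continuous_norm_sq_comp_inv h) (hasCompactSupport_norm_sq_comp_inv h)
    (sq_nonneg D) (fun w => ?_) v
  rw [← norm_sq_toL2]
  exact pow_le_pow_left₀ (norm_nonneg _) (hD w) 2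

theorem exists_norm_toL2_le (F : G.Cc) : ∃ D, 0 ≤ D ∧ ∀ v, ‖toL2 v F‖ ≤ D := by
  obtain ⟨D, hD⟩ := bddAbove_integral_haar (continuous_norm_sq_comp_inv F)
    (hasCompactSupport_norm_sq_comp_inv F)
  refine ⟨√D, Real.sqrt_nonneg _, fun v => Real.le_sqrt_of_sq_le ?_⟩
  rw [norm_sq_toL2]
  exact hD ⟨v, rfl⟩

theorem norm_map_star_mul_self {E : Type*} [NormedAddCommGroup E] [InnerProductSpace ℂ E]
    [CompleteSpace E] (π : G.Cc →⋆ₙₐ[ℂ] (E →L[ℂ] E)) (f : G.Cc) :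
    ‖π (star f * f)‖ = ‖π f‖ ^ 2 := by
  rw [map_mul, map_star, CStarRing.norm_star_mul_self, sq]

theorem norm_ind_star_mul_self (u : G.Obj) (f : G.Cc) : ‖ind u (star f * f)‖ = ‖ind u f‖ ^ 2 :=
  norm_map_star_mul_self (ind u) f

theorem isSelfAdjoint_ind_star_mul_self (u : G.Obj) (f : G.Cc) :
    IsSelfAdjoint (ind u (star f * f)) := by
  rw [map_mul, map_star]
  exact IsSelfAdjoint.star_mul_self _

/-- On g in `C_c`, the powers of the operator are convolutions by the pullback of powers of F. Their
L²-norms grow at most like M^n because M bounds F in every Ind(δ_v) of H; the spectral estimate for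
self-adjoint operators concludes. -/
theorem norm_ind_induced_le (φ : PartialMorphism G H) {F : H.Cc} {M : ℝ} (hM0 : 0 ≤ M)
    (hM : ∀ v, ‖ind v F‖ ≤ M) (u : G.Obj) (hsa : IsSelfAdjoint (ind u (φ.induced F))) :
    ‖ind u (φ.induced F)‖ ≤ M := by
  obtain ⟨D, hD0, hD⟩ := exists_norm_toL2_le F
  refine hsa.norm_le_of_pow_le hM0 (denseRange_toL2 u) ?_
  rintro _ ⟨g, rfl⟩
  refine ⟨(∫ a, ‖g (G.inv a)‖ ∂(G.haar u)) * D, fun n => ?_⟩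
  rw [ind_induced_pow_toL2, mul_assoc, mul_comm D]
  refine norm_toL2_induced_mul_le φ _ g (mul_nonneg (pow_nonneg hM0 n) hD0) (fun v => ?_) u
  exact (norm_toL2_convPow_le _ hM0 (hM v) n).trans
    (mul_le_mul_of_nonneg_left (hD v) (pow_nonneg hM0 n))

/-- The C*-identity reduces the claim to f^* * f, which acts by self-adjoint operators. -/
theorem normMin_induced_le (φ : PartialMorphism G H) (f : H.Cc) :
    G.normMin (φ.induced f) ≤ H.normMin f := by
  refine normMin_le (normMin_nonneg f) fun u => ?_
  have hi : φ.induced (star f * f) = star (φ.induced f) * φ.induced f := by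
    rw [φ.induced_mul, φ.induced_star]
  have hT := norm_ind_induced_le φ (sq_nonneg (H.normMin f)) (F := star f * f) (fun v => by
    rw [norm_ind_star_mul_self]
    exact pow_le_pow_left₀ (norm_nonneg _) (norm_ind_le_normMin v f) 2) u (by
    rw [hi]
    exact isSelfAdjoint_ind_star_mul_self u _)
  rw [hi, norm_ind_star_mul_self] at hT
  exact (sq_le_sq₀ (norm_nonneg _) (normMin_nonneg f)).1 hT

end TwistedGroupoid

/-! ### From a contractive family of norms to the functor -/

namespace TwistedGroupoid

/-- A norm with completions which is decreased by pullback along partial morphisms, and which is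
the supremum norm on spaces, defines a functor extending Gelfand duality. -/
theorem exists_functor (N : ∀ G : TwistedGroupoid.{u}, G.Cc → ℝ)
    (hex : ∀ G : TwistedGroupoid.{u}, ∃ (A : CStarCat.{u}) (ι : G.Cc →⋆ₙₐ[ℂ] A),
      G.IsCompletion (N G) ι)
    (hle : ∀ {G H : TwistedGroupoid.{u}} (φ : PartialMorphism G H) (f : H.Cc),
      N G (φ.induced f) ≤ N H f)
    (hsp : ∀ X : LCSpace.{u}, ∃ κ : X.toTwistedGroupoid.Cc →⋆ₙₐ[ℂ] (⟨C₀(X, ℂ)⟩ : CStarCat.{u}),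
      (∀ f, κ f = X.toC₀ f) ∧ X.toTwistedGroupoid.IsCompletion (N X.toTwistedGroupoid) κ) :
    ∃ (Γ : TwistedGroupoid.{u}ᵒᵖ ⥤ CStarCat.{u})
        (ι : ∀ G : TwistedGroupoid.{u}, G.Cc →⋆ₙₐ[ℂ] Γ.obj (Opposite.op G)),
      (∀ G : TwistedGroupoid.{u}, G.IsCompletion (N G) (ι G)) ∧
      (∀ (G H : TwistedGroupoid.{u}) (φ : G ⟶ H) (f : H.Cc),
        (Γ.map φ.op).hom (ι H f) = ι G (PartialMorphism.induced φ f)) ∧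
      (∃ η : LCSpace.toGroupoids.op ⋙ Γ ≅ LCSpace.gelfand,
        ∀ (X : LCSpace.{u}) (f : X.toTwistedGroupoid.Cc),
          (η.hom.app (Opposite.op X)).hom (ι X.toTwistedGroupoid f) = X.toC₀ f) := by
  choose A ι hι using hex
  have hmap : ∀ {G H : TwistedGroupoid.{u}} (φ : PartialMorphism G H),
      ∃ F : A H →⋆ₙₐ[ℂ] A G, ∀ f, F (ι H f) = ι G (φ.induced f) := by
    intro G H φ
    obtain ⟨F, hF⟩ := exists_hom_extension (ι H) ((ι G).comp φ.inducedHom) (hι H).denseRange fun f => by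
      rw [(hι H).norm_eq, NonUnitalStarAlgHom.comp_apply, (hι G).norm_eq]
      exact hle φ f
    exact ⟨F, hF⟩
  choose F hF using @hmap
  let Γ : TwistedGroupoid.{u}ᵒᵖ ⥤ CStarCat.{u} :=
    { obj := fun G => A G.unop
      map := fun φ => ⟨F φ.unop⟩
      map_id := fun G => CStarCat.hom_ext_of_denseRange (hι G.unop).denseRange fun f => by
        refine (hF (PartialMorphism.id G.unop) f).trans ?_
        rw [PartialMorphism.induced_id]
        rfl
      map_comp := fun {G H L} φ ψ =>
        CStarCat.hom_ext_of_denseRange (hι G.unop).denseRange fun f => by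
        refine (hF (PartialMorphism.comp φ.unop ψ.unop) f).trans ?_
        rw [PartialMorphism.induced_comp, ← hF, ← hF]
        rfl }
  refine ⟨Γ, ι, hι, fun G H φ f => hF φ f, ?_⟩
  have hiso : ∀ X : LCSpace.{u}, ∃ e : A X.toTwistedGroupoid ≅ ⟨C₀(X, ℂ)⟩,
      ∀ f, e.hom.hom (ι X.toTwistedGroupoid f) = X.toC₀ f := by
    intro X
    obtain ⟨κ, hκ, hc⟩ := hsp X
    obtain ⟨e, he⟩ := (hι X.toTwistedGroupoid).exists_iso hc
    exact ⟨e, fun f => (he f).trans (hκ f)⟩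
  choose e he using hiso
  refine ⟨NatIso.ofComponents (fun X => e X.unop) fun {X Y} φ => ?_, fun X f => he X f⟩
  refine CStarCat.hom_ext_of_denseRange (hι X.unop.toTwistedGroupoid).denseRange fun f => ?_
  -- On `C_c` the naturality square says that the induced map of an everywhere defined morphism is
  -- plain composition.
  have h1 : (e Y.unop).hom.hom (F (LCSpace.toGroupoids.map φ.unop)
      (ι X.unop.toTwistedGroupoid f)) = (LCSpace.gelfand.map φ).hom ((e X.unop).hom.hom
        (ι X.unop.toTwistedGroupoid f)) := by
    rw [he]
    refine (congrArg (e Y.unop).hom.hom (hF (G := Y.unop.toTwistedGroupoid)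
      (H := X.unop.toTwistedGroupoid) (LCSpace.toGroupoids.map φ.unop) f)).trans ?_
    refine (he _ _).trans ?_
    refine ZeroAtInftyContinuousMap.ext fun x => ?_
    exact PartialMorphism.induced_of_mem (LCSpace.toGroupoids.map φ.unop) f trivial
  exact h1

end TwistedGroupoid

namespace TwistedGroupoid

theorem norm_toL2_mul_le {G : TwistedGroupoid.{u}} (u : G.Obj) (f g : G.Cc) :
    ‖toL2 u (f * g)‖ ≤ G.normMin f * ‖toL2 u g‖ := by
  rw [← ind_toL2]
  exact (ind u f).le_of_opNorm_le (norm_ind_le_normMin u f) _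

end TwistedGroupoid

/-! ### Spaces: both norms are the supremum norm -/

namespace LCSpace

open TwistedGroupoid

variable (X : LCSpace.{u})

theorem integral_haar (F : X.toTwistedGroupoid.Arr → ℂ) (x : X) :
    ∫ y, F y ∂(X.toTwistedGroupoid.haar x) = F x :=
  integral_dirac (α := X.toTwistedGroupoid.Arr) F x

theorem integral_haar_real (F : X.toTwistedGroupoid.Arr → ℝ) (x : X) :
    ∫ y, F y ∂(X.toTwistedGroupoid.haar x) = F x :=
  integral_dirac (α := X.toTwistedGroupoid.Arr) F x

theorem mul_apply (f g : X.toTwistedGroupoid.Cc) (x : X.toTwistedGroupoid.Arr) :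
    (f * g) x = f x * g x := by
  refine (X.integral_haar _ x).trans ?_
  have hx : X.toTwistedGroupoid.src x = X.toTwistedGroupoid.rng x := rfl
  rw [convIntegrand, dif_pos hx]
  exact mul_one _

theorem star_apply (f : X.toTwistedGroupoid.Cc) (x : X) : (star f) x = conj (f x) :=
  congrArg conj (mul_one (f x))

/-- The inclusion of `C_c(X)` in `C₀(X)` is a `*`-homomorphism. -/
noncomputable def inclusion : X.toTwistedGroupoid.Cc →⋆ₙₐ[ℂ] (⟨C₀(X, ℂ)⟩ : CStarCat.{u}) where
  toFun := X.toC₀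
  map_zero' := rfl
  map_add' _ _ := rfl
  map_smul' _ _ := rfl
  map_mul' f g := ZeroAtInftyContinuousMap.ext fun x => X.mul_apply f g x
  map_star' f := ZeroAtInftyContinuousMap.ext fun x => X.star_apply f x

theorem norm_apply_le_norm_toC₀ (f : X.toTwistedGroupoid.Cc) (x : X) : ‖f x‖ ≤ ‖X.toC₀ f‖ := by
  rw [← ZeroAtInftyContinuousMap.norm_toBCF_eq_norm]
  exact (X.toC₀ f).toBCF.norm_coe_le_norm x

theorem norm_toC₀_le {f : X.toTwistedGroupoid.Cc} {C : ℝ} (hC : 0 ≤ C) (h : ∀ x : X, ‖f x‖ ≤ C) :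
    ‖X.toC₀ f‖ ≤ C := by
  rw [← ZeroAtInftyContinuousMap.norm_toBCF_eq_norm]
  exact (BoundedContinuousFunction.norm_le hC).2 h

theorem normI_le (f : X.toTwistedGroupoid.Cc) : X.toTwistedGroupoid.normI f ≤ ‖X.toC₀ f‖ :=
  TwistedGroupoid.normI_le (norm_nonneg _)
    (fun x => (X.integral_haar_real (fun y => ‖f y‖) x).trans_le (X.norm_apply_le_norm_toC₀ f x))
    (fun x => (X.integral_haar_real (fun y => ‖f y‖) x).trans_le (X.norm_apply_le_norm_toC₀ f x))

theorem norm_toL2 (f : X.toTwistedGroupoid.Cc) (x : X) :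
    ‖toL2 (G := X.toTwistedGroupoid) x f‖ = ‖f x‖ := by
  refine (sq_eq_sq₀ (norm_nonneg _) (norm_nonneg _)).1 ?_
  exact (norm_sq_toL2 (G := X.toTwistedGroupoid) x f).trans
    (X.integral_haar_real (fun y => ‖f y‖ ^ 2) x)

/-- On L² of the point mass at x, f acts as the scalar f(x). Testing on the vector f itself gives
|f(x)|² ≤ N |f(x)|, with N the minimal norm. -/
theorem norm_toC₀_le_normMin (f : X.toTwistedGroupoid.Cc) :
    ‖X.toC₀ f‖ ≤ X.toTwistedGroupoid.normMin f := by
  refine X.norm_toC₀_le (normMin_nonneg f) fun x => ?_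
  have h := norm_toL2_mul_le (G := X.toTwistedGroupoid) x f f
  rw [X.norm_toL2, X.norm_toL2] at h
  replace h : ‖f x‖ * ‖f x‖ ≤ X.toTwistedGroupoid.normMin f * ‖f x‖ :=
    ((norm_mul (f x) (f x)).symm.trans (congrArg norm (X.mul_apply f f x).symm)).trans_le h
  rcases eq_or_ne ‖f x‖ 0 with h0 | h0
  · rw [h0]; exact normMin_nonneg f
  · exact le_of_mul_le_mul_right h (lt_of_le_of_ne (norm_nonneg _) h0.symm)

/-- The general chain minimal ≤ maximal ≤ I-norm is closed by the I-norm of a space being at most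
the supremum norm. -/
theorem norm_toC₀_eq_normMin (f : X.toTwistedGroupoid.Cc) :
    ‖X.toC₀ f‖ = X.toTwistedGroupoid.normMin f :=
  le_antisymm (X.norm_toC₀_le_normMin f)
    ((normMin_le_normMax f).trans ((normMax_le_normI f).trans (X.normI_le f)))

theorem norm_toC₀_eq_normMax (f : X.toTwistedGroupoid.Cc) :
    ‖X.toC₀ f‖ = X.toTwistedGroupoid.normMax f :=
  le_antisymm ((X.norm_toC₀_le_normMin f).trans (normMin_le_normMax f))
    ((normMax_le_normI f).trans (X.normI_le f))

theorem denseRange_toC₀ : DenseRange X.toC₀ := by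
  intro h
  rw [Metric.mem_closure_iff]
  intro ε hε
  obtain ⟨K, hK, hKs⟩ := mem_cocompact.1
    (h.zero_at_infty' (Metric.ball_mem_nhds (0 : ℂ) (half_pos hε)))
  obtain ⟨χ, h1, -, hcs, h01⟩ := exists_continuous_one_zero_of_isCompact hK isClosed_empty
    (disjoint_empty K)
  -- Cutting h off by χ changes it only outside K, where |h| < ε/2.
  let g : C_c(X, ℂ) := ⟨⟨fun x => (χ x : ℂ) * h x, by fun_prop⟩,
    HasCompactSupport.mul_right (hcs.comp_left (g := fun t : ℝ => (t : ℂ)) (by simp))⟩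
  refine ⟨X.toC₀ g, mem_range_self _, ?_⟩
  rw [dist_eq_norm, ← ZeroAtInftyContinuousMap.norm_toBCF_eq_norm]
  refine lt_of_le_of_lt ((BoundedContinuousFunction.norm_le (half_pos hε).le).2 fun x => ?_)
    (half_lt_self hε)
  change ‖h x - (χ x : ℂ) * h x‖ ≤ ε / 2
  by_cases hx : x ∈ K
  · rw [h1 hx]
    simpa using (half_pos hε).le
  · have h2 : ‖h x‖ < ε / 2 := by simpa using hKs hx
    have h3 : h x - (χ x : ℂ) * h x = ((1 - χ x : ℝ) : ℂ) * h x := by push_cast; ring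
    rw [h3, norm_mul, Complex.norm_real, Real.norm_of_nonneg (sub_nonneg.2 (h01 x).2)]
    exact (mul_le_of_le_one_left (norm_nonneg _) (sub_le_self _ (h01 x).1)).trans h2.le

theorem isCompletion_inclusion {N : X.toTwistedGroupoid.Cc → ℝ} (hN : ∀ f, ‖X.toC₀ f‖ = N f) :
    X.toTwistedGroupoid.IsCompletion N X.inclusion where
  injective _ _ h := Cc.ext fun x => DFunLike.congr_fun (F := C₀(X, ℂ)) h x
  norm_eq := hN
  denseRange := X.denseRange_toC₀

end LCSpace

theorem mainTheorem5 :
    (∃ (Γ : TwistedGroupoid.{u}ᵒᵖ ⥤ CStarCat.{u})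
        (ι : ∀ G : TwistedGroupoid.{u}, G.Cc →⋆ₙₐ[ℂ] Γ.obj (Opposite.op G)),
      (∀ G : TwistedGroupoid.{u}, G.IsCompletion G.normMax (ι G)) ∧
      (∀ (G H : TwistedGroupoid.{u}) (φ : G ⟶ H) (f : H.Cc),
        (Γ.map φ.op).hom (ι H f) = ι G (PartialMorphism.induced φ f)) ∧
      (∃ η : LCSpace.toGroupoids.op ⋙ Γ ≅ LCSpace.gelfand,
        ∀ (X : LCSpace.{u}) (f : X.toTwistedGroupoid.Cc),
          (η.hom.app (Opposite.op X)).hom (ι X.toTwistedGroupoid f) = X.toC₀ f)) ∧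
    (∃ (Γ : TwistedGroupoid.{u}ᵒᵖ ⥤ CStarCat.{u})
        (ι : ∀ G : TwistedGroupoid.{u}, G.Cc →⋆ₙₐ[ℂ] Γ.obj (Opposite.op G)),
      (∀ G : TwistedGroupoid.{u}, G.IsCompletion G.normMin (ι G)) ∧
      (∀ (G H : TwistedGroupoid.{u}) (φ : G ⟶ H) (f : H.Cc),
        (Γ.map φ.op).hom (ι H f) = ι G (PartialMorphism.induced φ f)) ∧
      (∃ η : LCSpace.toGroupoids.op ⋙ Γ ≅ LCSpace.gelfand,
        ∀ (X : LCSpace.{u}) (f : X.toTwistedGroupoid.Cc),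
          (η.hom.app (Opposite.op X)).hom (ι X.toTwistedGroupoid f) = X.toC₀ f)) :=
  ⟨TwistedGroupoid.exists_functor _ TwistedGroupoid.exists_isCompletion_normMax
      (fun φ f => φ.normMax_induced_le f)
      fun X => ⟨X.inclusion, fun _ => rfl, X.isCompletion_inclusion X.norm_toC₀_eq_normMax⟩,
    TwistedGroupoid.exists_functor _ TwistedGroupoid.exists_isCompletion_normMin
      (fun φ f => TwistedGroupoid.normMin_induced_le φ f)
      fun X => ⟨X.inclusion, fun _ => rfl, X.isCompletion_inclusion X.norm_toC₀_eq_normMin⟩⟩
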